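/- Let $M$ be a finite-dimensional compact $C^r$ manifold (possibly with boundary), $r\in\{0,1,2,\dots\}$, and let $\nu$ be a Borel probability measure on $M$. Write $L^2(\nu)$ for the complex Hilbert space of square-integrable functions. For a continuous kernel $k:M\times M\to\mathbb R$, let $G_k:L^2(\nu)\to L^2(\nu)$, $G_kf(x)=\int_M k(x,y)f(y)\,d\nu(y)$. The kernel $k$ is called *positive-definite* if for all finite families of distinct points $x_1,\dots,x_n\in M$ the matrix $[k(x_i,x_j)]$ is positive semidefinite; *$L^2(\nu)$-strictly-positive* if $G_k$ is self-adjoint and $\langle f,G_kf\rangle>0$ for all $f\neq0$ in $L^2(\nu)$. A bounded operator $G$ on $L^2(\nu)$ is called *Markov* if $G\ge0$ (i.e. $G$ is a positive semidefinite self-adjoint operator), $\int_M Gf\,d\nu=\int_M f\,d\nu$ for all $f\in L^2(\nu)$, and $Gf=f$ for constant $f$; it is *Markov ergodic* if moreover $Gf=f$ holds only for constant $f$. A kernel $k$ is called Markov ergodic if $G_k$ is. Let $p:M\times M\to\mathbb R$ be a $C^r$, symmetric, positive-definite kernel that is $L^2(\nu)$-strictly-positive and Markov ergodic, and let $\mathcal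 H$ be the reproducing kernel Hilbert space (RKHS) of complex functions on $M$ with kernel $p$. Let $\{\phi_j\}$ be an orthonormal basis of $L^2(\nu)$ (finite or infinite) consisting of real-valued eigenfunctions of $G_p$, with eigenvalues $\lambda_j$ (which are then strictly positive). For $\tau>0$ define $$\psi_j(x)=\lambda_j^{-1/2}\int_M p(x,y)\phi_j(y)\,d\nu(y),\qquad \lambda_{\tau,j}=e^{\tau(1-1/\lambda_j)},\qquad \psi_{\tau,j}=\sqrt{\lambda_{\tau,j}/\lambda_j}\;\psi_j,\qquad p_\tau(x,y)=\sum_j\psi_{\tau,j}(x)\psi_{\tau,j}(y).$$ Then for every $\tau>0$ the series for $p_\tau$ converges (unconditionally) in $C^r(M\times M)$ to a $C^r$, symmetric function, and the following hold. (i) For every $\tau>0$, $p_\tau$ is a positive-definite kernel on $M$, and it is $L^2(\nu)$-strictly-positive and Markov ergodic. (ii) For every $\tau>0$, the RKHS $\mathcal H_\tau$ of complex functions on $M$ with kernel $p_\tau$ is dense in $L^2(\nu)$ (its elements are square-integrable and their classes form a dense subspace), and $\{\psi_{\tau,j}\}_j$ is an orthonormal basis of $\mathcal H_\tau$. For all $0<\tau_1<\tau_2$,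 as sets of functions, $\mathcal H_{\tau_2}\subseteq\mathcal H_{\tau_1}\subseteq\mathcal H$. (iii) For $\tau>0$ the integral operator $P_\tau:L^2(\nu)\to\mathcal H_\tau$, $P_\tau f=\int_M p_\tau(\cdot,y)f(y)\,d\nu(y)$, is well defined and bounded, and $G_\tau:=P_\tau^*P_\tau$ equals $G_{p_\tau}$. With $G_0:=\mathrm{Id}$, the family $\{G_\tau\}_{\tau\ge0}$ is a strongly continuous semigroup ($G_{\sigma+\tau}=G_\sigma G_\tau$ for $\sigma,\tau\ge0$, and $\tau\mapsto G_\tau f$ is continuous on $[0,\infty)$ for each $f\in L^2(\nu)$) consisting of self-adjoint Markov operators. -/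

import Mathlib

open MeasureTheory Filter Topology
open scoped Manifold ContDiff ENNReal NNReal

noncomputable section

/-! ### Kernels and their integral operators -/

section Kernel

variable {M : Type*} [TopologicalSpace M]

/-- A real (continuous) kernel is symmetric. -/
def IsSymmKernel (k : C(M × M, ℝ)) : Prop :=
  ∀ x y, k (x, y) = k (y, x)

/-- A kernel is positive-definite: all kernel matrices on finitely many distinct points are
positive semidefinite. -/
def IsPosDefKernel (k : C(M × M, ℝ)) : Prop :=
  ∀ (n : ℕ) (x : Fin n → M), Function.Injective x →
    (Matrix.of fun i j => k (x i, x j)).PosSemidef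

variable [CompactSpace M] [MeasurableSpace M] [BorelSpace M]

/-- The kernel section `k (x, ·)`, complexified, as an element of `L²(ν)`. -/
def kernelSection (k : C(M × M, ℝ)) (ν : Measure M) [IsFiniteMeasure ν] :
    C(M, Lp ℂ 2 ν) where
  toFun x := ContinuousMap.toLp 2 ν ℂ
    ((ContinuousMap.curry ((⟨Complex.ofReal, Complex.continuous_ofReal⟩ : C(ℝ, ℂ)).comp k)) x)
  continuous_toFun := (ContinuousMap.toLp 2 ν ℂ).continuous.comp (ContinuousMap.continuous _)

theorem integral_kernel_eq_inner (k : C(M × M, ℝ)) (ν : Measure M) [IsFiniteMeasure ν]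
    (f : Lp ℂ 2 ν) (x : M) :
    ∫ y, (k (x, y) : ℂ) * f y ∂ν = inner ℂ (kernelSection k ν x) f := by
  rw [L2.inner_def]
  refine integral_congr_ae ?_
  filter_upwards [ContinuousMap.coeFn_toLp (p := 2) (𝕜 := ℂ) ν
    ((ContinuousMap.curry ((⟨Complex.ofReal, Complex.continuous_ofReal⟩ : C(ℝ, ℂ)).comp k)) x)]
    with y hy
  have h : (kernelSection k ν x : M → ℂ) y = (k (x, y) : ℂ) := hy
  simp [h, mul_comm]

/-- The integral operator `K : L²(ν) → C⁰(M)`, `(K f)(x) = ∫ k(x, y) f(y) dν(y)`. -/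
def kernelInt (k : C(M × M, ℝ)) (ν : Measure M) [IsFiniteMeasure ν] :
    Lp ℂ 2 ν →L[ℂ] C(M, ℂ) :=
  LinearMap.mkContinuous
    { toFun := fun f =>
        { toFun := fun x => ∫ y, (k (x, y) : ℂ) * f y ∂ν
          continuous_toFun := by
            simp_rw [integral_kernel_eq_inner]
            fun_prop }
      map_add' := fun f g => by
        ext x
        change ∫ y, (k (x, y) : ℂ) * (f + g) y ∂ν =
          ∫ y, (k (x, y) : ℂ) * f y ∂ν + ∫ y, (k (x, y) : ℂ) * g y ∂ν
        simp_rw [integral_kernel_eq_inner, inner_add_right]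
      map_smul' := fun c f => by
        ext x
        change ∫ y, (k (x, y) : ℂ) * (c • f) y ∂ν = c • ∫ y, (k (x, y) : ℂ) * f y ∂ν
        simp_rw [integral_kernel_eq_inner, inner_smul_right, smul_eq_mul] }
    ‖kernelSection k ν‖
    (fun f => by
      rw [ContinuousMap.norm_le _ (by positivity)]
      intro x
      simp only [LinearMap.coe_mk, AddHom.coe_mk, ContinuousMap.coe_mk, integral_kernel_eq_inner]
      exact (norm_inner_le_norm _ _).trans
        (mul_le_mul_of_nonneg_right (ContinuousMap.norm_coe_le_norm _ x) (norm_nonneg _)))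

theorem kernelInt_apply (k : C(M × M, ℝ)) (ν : Measure M) [IsFiniteMeasure ν]
    (f : Lp ℂ 2 ν) (x : M) :
    kernelInt k ν f x = ∫ y, (k (x, y) : ℂ) * f y ∂ν := rfl

/-- The integral operator `G = ι ∘ K` on `L²(ν)`, with `ι : C⁰(M) → L²(ν)` the inclusion. -/
def kernelOp (k : C(M × M, ℝ)) (ν : Measure M) [IsFiniteMeasure ν] :
    Lp ℂ 2 ν →L[ℂ] Lp ℂ 2 ν :=
  (ContinuousMap.toLp 2 ν ℂ) ∘L (kernelInt k ν)

end Kernel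

/-! ### Positivity, Markov property, ergodicity, Markov semigroups on `L²(ν)` -/

section Operators

variable {M : Type*} [MeasurableSpace M]

/-- `G > 0`: `G` is a positive (self-adjoint) operator with `⟨f, G f⟩ > 0` for `f ≠ 0`. -/
def IsStrictlyPosOp {ν : Measure M} (G : Lp ℂ 2 ν →L[ℂ] Lp ℂ 2 ν) : Prop :=
  G.IsPositive ∧ ∀ f : Lp ℂ 2 ν, f ≠ 0 → 0 < (inner ℂ f (G f)).re

/-- `G` is a Markov operator on `L²(ν)`: `G ≥ 0` as an operator, `G` preserves integrals, and `G`
fixes the constants. -/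
structure IsMarkovOp {ν : Measure M} [IsFiniteMeasure ν]
    (G : Lp ℂ 2 ν →L[ℂ] Lp ℂ 2 ν) : Prop where
  nonneg : G.IsPositive
  integral_eq : ∀ f : Lp ℂ 2 ν, ∫ x, G f x ∂ν = ∫ x, f x ∂ν
  map_const : ∀ c : ℂ, G (Lp.const 2 ν c) = Lp.const 2 ν c

/-- An ergodic Markov operator: the only fixed vectors are the constants. -/
def IsMarkovErgodicOp {ν : Measure M} [IsFiniteMeasure ν]
    (G : Lp ℂ 2 ν →L[ℂ] Lp ℂ 2 ν) : Prop :=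
  IsMarkovOp G ∧ ∀ f : Lp ℂ 2 ν, G f = f ↔ ∃ c : ℂ, f = Lp.const 2 ν c

/-- A strongly continuous semigroup, indexed by `[0, ∞)`, of self-adjoint Markov operators. -/
structure IsSelfAdjointMarkovSemigroup {ν : Measure M} [IsFiniteMeasure ν]
    (T : ℝ≥0 → (Lp ℂ 2 ν →L[ℂ] Lp ℂ 2 ν)) : Prop where
  zero : T 0 = ContinuousLinearMap.id ℂ (Lp ℂ 2 ν)
  add : ∀ s t, T (s + t) = T s ∘L T t
  strongly_continuous : ∀ f : Lp ℂ 2 ν, Continuous fun t => T t f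
  selfAdjoint : ∀ t, IsSelfAdjoint (T t)
  markov : ∀ t, IsMarkovOp (T t)

variable [TopologicalSpace M] [CompactSpace M] [BorelSpace M]

/-- The family `G₀ = id` and `G_τ` the integral operator of the kernel `q τ` for `τ > 0`. -/
def kernelFamilyOp (q : ℝ → C(M × M, ℝ)) (ν : Measure M) [IsFiniteMeasure ν] (t : ℝ≥0) :
    Lp ℂ 2 ν →L[ℂ] Lp ℂ 2 ν :=
  if t = 0 then ContinuousLinearMap.id ℂ (Lp ℂ 2 ν) else kernelOp (q t) ν

end Operators

/-! ### Reproducing kernel Hilbert spaces -/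

section RKHS

variable {M : Type*} [TopologicalSpace M]

/-- `𝓗` is the reproducing kernel Hilbert space of complex functions on `M` with reproducing
kernel `k`. -/
def HasReproducingKernel (𝓗 : Type*) [NormedAddCommGroup 𝓗] [InnerProductSpace ℂ 𝓗]
    [CompleteSpace 𝓗] [RKHS ℂ 𝓗 M ℂ] (k : C(M × M, ℝ)) : Prop :=
  ∀ x y, RKHS.kernel 𝓗 x y 1 = (k (x, y) : ℂ)

/-- The set of functions on `M` that make up the reproducing kernel Hilbert space `𝓗`. -/
def rkhsFunctions {M : Type*} (𝓗 : Type*) [NormedAddCommGroup 𝓗] [InnerProductSpace ℂ 𝓗]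
    [RKHS ℂ 𝓗 M ℂ] : Set (M → ℂ) :=
  Set.range fun f : 𝓗 => (f : M → ℂ)

/-- The functions in `𝓗` are square-integrable, and their classes are dense in `L²(ν)`. -/
def IsDenseInL2 {M : Type*} [MeasurableSpace M] (𝓗 : Type*) [NormedAddCommGroup 𝓗]
    [InnerProductSpace ℂ 𝓗] [RKHS ℂ 𝓗 M ℂ] (ν : Measure M) : Prop :=
  (∀ f ∈ rkhsFunctions 𝓗, MemLp f 2 ν) ∧
    Dense {g : Lp ℂ 2 ν | ∃ f ∈ rkhsFunctions 𝓗, g =ᵐ[ν] f}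

end RKHS

/-! ### Convergence in `C^r` -/

/-- Convergence in `C^r(N)`: all functions are `C^r`, and in each chart all derivatives of order at
most `r` converge uniformly on compact sets. For compact `N` this is convergence in the `C^r` norm
defined by any Riemannian metric (or any finite atlas). -/
def TendstoCr {E H N : Type*} [NormedAddCommGroup E] [NormedSpace ℝ E] [TopologicalSpace H]
    (J : ModelWithCorners ℝ E H) [TopologicalSpace N] [ChartedSpace H N] (r : ℕ)
    {α : Type*} (F : α → N → ℝ) (l : Filter α) (f : N → ℝ) : Prop :=
  (∀ a, ContMDiff J 𝓘(ℝ, ℝ) r (F a)) ∧ ContMDiff J 𝓘(ℝ, ℝ) r f ∧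
    ∀ z : N, ∀ m ≤ r, ∀ K ⊆ (extChartAt J z).target, IsCompact K →
      TendstoUniformlyOn
        (fun a => iteratedFDerivWithin ℝ m (F a ∘ (extChartAt J z).symm) (extChartAt J z).target)
        (iteratedFDerivWithin ℝ m (f ∘ (extChartAt J z).symm) (extChartAt J z).target) l K

/-! ### The one-parameter family -/

section Family

variable {M : Type*} [TopologicalSpace M] [CompactSpace M] [MeasurableSpace M] [BorelSpace M]

/-- `λ_τ = exp (τ (1 - λ⁻¹))`. -/
def eigTau (τ l : ℝ) : ℝ := Real.exp (τ * (1 - l⁻¹))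

/-- `ψ = λ^{-1/2} K φ` for a real-valued eigenfunction `φ` with eigenvalue `l = λ`; `K φ` is then
real-valued. -/
def psi (k : C(M × M, ℝ)) (ν : Measure M) [IsFiniteMeasure ν] (l : ℝ) (φ : Lp ℂ 2 ν)
    (x : M) : ℝ :=
  (√l)⁻¹ * (kernelInt k ν φ x).re

/-- `ψ_τ = (λ_τ / λ)^{1/2} ψ`. -/
def psiTau (k : C(M × M, ℝ)) (ν : Measure M) [IsFiniteMeasure ν] (τ l : ℝ) (φ : Lp ℂ 2 ν)
    (x : M) : ℝ :=
  √(eigTau τ l / l) * psi k ν l φ x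

end Family

end

/-! Write $k_x=p(x,\cdot)\in L^2(\nu)$. Since $K\phi_j(x)=\langle k_x,\phi_j\rangle$ is real,
$p_\tau(x,y)=B_\tau(k_x,k_y)$ with $B_\tau=\sum_j c_j\,\ell_j\otimes\ell_j$,
$\ell_j=\mathrm{Re}\langle\phi_j,\cdot\rangle$ and $c_j=\lambda_{\tau,j}/\lambda_j^2$. Convergence
in $C^r$ then splits into two facts, joined by `tendstoCr_of_tendsto_bilinear`: the map $x\mapsto
k_x$ is $C^r$ (`contMDiff_curry`), and the series for $B_\tau$ converges in norm (`hasSum_sumForm`).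
No derivative of a single $\psi_j$ is estimated. As $\|\ell_j\|\le1$, the second fact only needs
$\sum_j c_j<\infty$: the factor $e^{-\tau/\lambda_j}$ beats every power of $1/\lambda_j$, so $c_j\le
C\lambda_j^2$, and $\sum_j\lambda_j^2<\infty$ because $G_p$ is Hilbert–Schmidt
(`summable_eigenvalue_sq`).

On $L^2(\nu)$ everything is diagonal: $G_\tau\phi_j=\lambda_{\tau,j}\phi_j$ (`kernelOp_kernelTau`).
Strict positivity is $\lambda_{\tau,j}>0$, the semigroup law is that of the exponential, and
ergodicity passes from $G_p$ to $G_\tau$ because $\lambda_{\tau,j}=1$ exactly when $\lambda_j=1$.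

For an RKHS with kernel $k$, the inclusion $R$ into $L^2(\nu)$ satisfies $RR^*=G_k$. Hence the
vectors $\mu_j^{-1/2}R^*\phi_j$ are orthonormal when $G_k\phi_j=\mu_j\phi_j$; for $k=p_\tau$ they
are the $\psi_{\tau,j}$, and they are complete because $p_\tau$ is the sum of their products.
Nesting holds because the bases differ by bounded weights. -/

noncomputable section

/-! ### Smooth dependence of kernel sections on the base point -/

section Curry

variable {E F K : Type*} [NormedAddCommGroup E]
  [NormedAddCommGroup F] [TopologicalSpace K]

/-- The section `g u`, as a continuous map whenever it is continuous. -/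
def sectionMap (g : E → K → F) (u : E) : C(K, F) :=
  open Classical in if h : Continuous (g u) then ⟨g u, h⟩ else 0

theorem sectionMap_apply {g : E → K → F} {U : Set E}
    (hg : ContinuousOn (Function.uncurry g) (U ×ˢ Set.univ)) {u : E} (hu : u ∈ U) (y : K) :
    sectionMap g u y = g u y := by
  have h : Continuous (g u) := by
    have : Continuous (Function.uncurry g ∘ fun y : K => (u, y)) :=
      hg.comp_continuous (by fun_prop) (fun y => ⟨hu, trivial⟩)
    exact this
  simp [sectionMap, h]

theorem continuousOn_of_apply_eq {g : E → K → F} {U : Set E}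
    (hg : ContinuousOn (Function.uncurry g) (U ×ˢ Set.univ)) {G : E → C(K, F)}
    (hG : ∀ u ∈ U, ∀ y, G u y = g u y) : ContinuousOn G U := by
  rw [continuousOn_iff_continuous_domRestrict]
  refine ContinuousMap.continuous_of_continuous_uncurry _ ?_
  have : Continuous (Function.uncurry g ∘ fun z : U × K => ((z.1 : E), z.2)) :=
    hg.comp_continuous (by fun_prop) (fun z => ⟨z.1.2, trivial⟩)
  refine this.congr fun z => ?_
  simp [Function.uncurry, hG z.1 z.1.2]

variable [NormedSpace ℝ E] [CompactSpace K] [NormedSpace ℝ F]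

/-- A continuous family of linear maps, as a linear map into continuous functions. -/
def flipCLM (D : C(K, E →L[ℝ] F)) : E →L[ℝ] C(K, F) :=
  LinearMap.mkContinuous
    { toFun := fun v => ⟨fun y => D y v, by fun_prop⟩
      map_add' := fun v w => by ext y; simp
      map_smul' := fun c v => by ext y; simp } ‖D‖
    (fun v => by
      rw [ContinuousMap.norm_le _ (by positivity)]
      intro y
      exact (D y).le_of_opNorm_le (D.norm_coe_le_norm y) v)

@[simp]
theorem flipCLM_apply (D : C(K, E →L[ℝ] F)) (v : E) (y : K) : flipCLM D v y = D y v := rfl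

/-- The mean value inequality for $G(\cdot)(y)-D(u_0)(y)$ gives the same error $c\|u-u_0\|$ for all
$y$, because $D$ is continuous in the sup norm. It requires a convex domain; a small ball inside $O$
meets $C$ in one. -/
theorem hasFDerivWithinAt_of_sections {O C : Set E} (hO : IsOpen O) (hC : Convex ℝ C)
    {G : E → C(K, F)} {D : E → C(K, E →L[ℝ] F)} (hD : ContinuousOn D (O ∩ C))
    (h : ∀ u ∈ O ∩ C, ∀ y, HasFDerivWithinAt (fun u => G u y) (D u y) (O ∩ C) u)
    {u₀ : E} (hu₀ : u₀ ∈ O ∩ C) :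
    HasFDerivWithinAt G (flipCLM (D u₀)) (O ∩ C) u₀ := by
  rw [hasFDerivWithinAt_iff_isLittleO, Asymptotics.isLittleO_iff]
  intro c hc
  obtain ⟨δ₁, hδ₁, hball₁⟩ := Metric.isOpen_iff.1 hO u₀ hu₀.1
  have hnear : {u | dist (D u) (D u₀) < c} ∈ 𝓝[O ∩ C] u₀ :=
    (hD u₀ hu₀).eventually (Metric.ball_mem_nhds (D u₀) hc)
  obtain ⟨δ₂, hδ₂, hball₂⟩ := Metric.mem_nhdsWithin_iff.1 hnear
  have hmem : Metric.ball u₀ (min δ₁ δ₂) ∩ (O ∩ C) ∈ 𝓝[O ∩ C] u₀ :=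
    inter_mem (mem_nhdsWithin_of_mem_nhds (Metric.ball_mem_nhds _ (lt_min hδ₁ hδ₂)))
      self_mem_nhdsWithin
  filter_upwards [hmem] with u hu
  rw [ContinuousMap.norm_le _ (by positivity)]
  intro y
  have hsub : Metric.ball u₀ (min δ₁ δ₂) ∩ C ⊆ O ∩ C := fun v hv =>
    ⟨hball₁ (Metric.ball_subset_ball (min_le_left _ _) hv.1), hv.2⟩
  refine ((convex_ball u₀ (min δ₁ δ₂)).inter hC).norm_image_sub_le_of_norm_hasFDerivWithin_le'
    (f := fun u => G u y) (f' := fun u => D u y) (φ := D u₀ y)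
    (fun v hv => (h v (hsub hv) y).mono hsub) (fun v hv => ?_)
    ⟨Metric.mem_ball_self (lt_min hδ₁ hδ₂), hu₀.2⟩ ⟨hu.1, hu.2.2⟩
  have h2 : dist (D v) (D u₀) < c :=
    hball₂ ⟨Metric.ball_subset_ball (min_le_right _ _) hv.1, hsub hv⟩
  rw [← dist_eq_norm]
  exact (ContinuousMap.dist_apply_le_dist y).trans h2.le

end Curry

/-! ### Joint smoothness in charts implies smoothness into $C(M)$ -/

section SmoothSections

variable {E H M : Type*} [NormedAddCommGroup E] [NormedSpace ℝ E]
  [TopologicalSpace H] (I : ModelWithCorners ℝ E H) [TopologicalSpace M] [ChartedSpace H M]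

/-- The function `g : E → M → ℝ` is jointly `C^n` on `U × M`, in the charts of `M`. -/
def JointlyContDiffOn (n : ℕ) (g : E → M → ℝ) (U : Set E) : Prop :=
  ∀ y₀ : M, ContDiffOn ℝ n (fun z : E × E => g z.1 ((extChartAt I y₀).symm z.2))
    (U ×ˢ (extChartAt I y₀).target)

variable {I} {n : ℕ} {g : E → M → ℝ} {U : Set E}

theorem JointlyContDiffOn.continuousOn (hg : JointlyContDiffOn I n g U) :
    ContinuousOn (Function.uncurry g) (U ×ˢ Set.univ) := by
  rintro ⟨u₀, y₀⟩ ⟨hu₀, -⟩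
  have h1 : ContinuousOn (Function.uncurry g) (U ×ˢ (extChartAt I y₀).source) := by
    have h2 : ContinuousOn (fun z : E × M => (z.1, extChartAt I y₀ z.2))
        (U ×ˢ (extChartAt I y₀).source) :=
      continuousOn_fst.prodMk
        ((continuousOn_extChartAt y₀).comp continuousOn_snd (fun z hz => hz.2))
    refine ((hg y₀).continuousOn.comp h2 fun z hz =>
      ⟨hz.1, (extChartAt I y₀).map_source hz.2⟩).congr fun z hz => ?_
    have h3 := (extChartAt I y₀).left_inv hz.2
    simp only [Function.uncurry, Function.comp_apply, h3]
  refine (h1 (u₀, y₀) ⟨hu₀, mem_extChartAt_source y₀⟩).mono_of_mem_nhdsWithin ?_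
  rw [nhdsWithin_prod_eq]
  exact prod_mem_prod self_mem_nhdsWithin
    (mem_nhdsWithin_of_mem_nhds (extChartAt_source_mem_nhds y₀))

theorem JointlyContDiffOn.hasFDerivWithinAt (hg : JointlyContDiffOn I (n + 1) g U)
    {u : E} (hu : u ∈ U) (y₀ : M) {w : E} (hw : w ∈ (extChartAt I y₀).target) :
    HasFDerivWithinAt (fun u => g u ((extChartAt I y₀).symm w))
      ((fderivWithin ℝ (fun z : E × E => g z.1 ((extChartAt I y₀).symm z.2))
        (U ×ˢ (extChartAt I y₀).target) (u, w)).comp (ContinuousLinearMap.inl ℝ E E)) U u := by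
  have h1 : DifferentiableWithinAt ℝ (fun z : E × E => g z.1 ((extChartAt I y₀).symm z.2))
      (U ×ˢ (extChartAt I y₀).target) (u, w) :=
    (hg y₀).differentiableOn (by simp) (u, w) ⟨hu, hw⟩
  exact h1.hasFDerivWithinAt.comp u (f := fun u => (u, w))
    (hasFDerivAt_prodMk_left u w).hasFDerivWithinAt (fun v hv => ⟨hv, hw⟩)

/-- The partial derivative along $v$ is the total derivative applied to $(v,0)$. This is the
inductive step: one derivative in the base point costs one order of joint smoothness. -/
theorem JointlyContDiffOn.fderivWithin_apply (hg : JointlyContDiffOn I (n + 1) g U)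
    (hU : UniqueDiffOn ℝ U) (v : E) :
    JointlyContDiffOn I n (fun u y => fderivWithin ℝ (fun u => g u y) U u v) U := by
  intro y₀
  have h1 := (hg y₀).fderivWithin (m := n) (hU.prod (uniqueDiffOn_extChartAt_target y₀))
    (by push_cast; exact le_rfl)
  refine (h1.clm_apply (contDiffOn_const (c := ((v, 0) : E × E)))).congr fun z hz => ?_
  beta_reduce
  rw [(hg.hasFDerivWithinAt hz.1 y₀ hz.2).fderivWithin (hU z.1 hz.1)]
  simp

variable [CompactSpace M] [FiniteDimensional ℝ E]

/-- Induction on $n$. As $E$ is finite-dimensional, it suffices that each directional derivative of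
$G$ is $C^n$; its sections are the directional derivatives of $g$, so the induction hypothesis
applies to them. -/
theorem contDiffOn_of_sections {O C : Set E} (hO : IsOpen O) (hC : Convex ℝ C)
    (hU : UniqueDiffOn ℝ (O ∩ C)) (n : ℕ) : ∀ (g : E → M → ℝ) (G : E → C(M, ℝ)),
    JointlyContDiffOn I n g (O ∩ C) → (∀ u ∈ O ∩ C, ∀ y, G u y = g u y) →
    ContDiffOn ℝ n G (O ∩ C) := by
  induction n with
  | zero =>
    intro g G hg hG
    rw [Nat.cast_zero, contDiffOn_zero]
    exact continuousOn_of_apply_eq hg.continuousOn hG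
  | succ n ih =>
    intro g G hg hG
    set g' : E → M → (E →L[ℝ] ℝ) := fun u y => fderivWithin ℝ (fun u => g u y) (O ∩ C) u
    have hg' : ContinuousOn (Function.uncurry g') ((O ∩ C) ×ˢ Set.univ) :=
      continuousOn_clm_apply.2 fun v => (hg.fderivWithin_apply hU v).continuousOn
    have hder : ∀ u ∈ O ∩ C, HasFDerivWithinAt G (flipCLM (sectionMap g' u)) (O ∩ C) u := by
      intro u hu
      refine hasFDerivWithinAt_of_sections hO hC
        (continuousOn_of_apply_eq hg' fun u hu y => sectionMap_apply hg' hu y) ?_ hu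
      intro u hu y
      rw [sectionMap_apply hg' hu]
      have h1 := hg.hasFDerivWithinAt hu y (mem_extChartAt_target y)
      rw [(extChartAt I y).left_inv (mem_extChartAt_source y)] at h1
      exact h1.differentiableWithinAt.hasFDerivWithinAt.congr (fun v hv => hG v hv y) (hG u hu y)
    push_cast
    refine contDiffOn_succ_of_fderiv_apply
      (fun u hu => (hder u hu).differentiableWithinAt) (by simp) fun v => ?_
    refine ih _ _ (hg.fderivWithin_apply hU v) fun u hu y => ?_
    rw [(hder u hu).fderivWithin (hU u hu), flipCLM_apply, sectionMap_apply hg' hu]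

theorem contMDiff_curry [IsManifold I n M] {p : C(M × M, ℝ)}
    (hp : ContMDiff (I.prod I) 𝓘(ℝ, ℝ) n p) :
    ContMDiff I 𝓘(ℝ, C(M, ℝ)) n p.curry := by
  intro x₀
  rw [contMDiffAt_iff_source, contMDiffWithinAt_iff_contDiffWithinAt]
  have htarget : (extChartAt I x₀).target = I.symm ⁻¹' (chartAt H x₀).target ∩ Set.range I :=
    extChartAt_target I x₀
  have hU := uniqueDiffOn_extChartAt_target (I := I) x₀
  have h1 : JointlyContDiffOn I n (fun u y => p ((extChartAt I x₀).symm u, y))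
      (extChartAt I x₀).target := by
    intro y₀
    have h2 := hp.comp_contMDiffOn (contMDiffOn_extChartAt_symm (I := I.prod I) (n := n) (x₀, y₀))
    have h3 := h2.contDiffOn
    rw [extChartAt_prod] at h3
    exact h3
  -- A chart target need not be convex, but it is an open set intersected with the convex range of
  -- $I$. This form also covers boundary points.
  rw [htarget] at hU h1
  have h4 := contDiffOn_of_sections ((chartAt H x₀).open_target.preimage I.continuous_symm)
    I.convex_range hU n _ (p.curry ∘ (extChartAt I x₀).symm) h1 (fun u hu y => rfl)
  rw [← htarget] at h4
  exact (h4 _ (mem_extChartAt_target x₀)).mono_of_mem_nhdsWithin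
    (extChartAt_target_mem_nhdsWithin x₀)

end SmoothSections

/-! ### Convergence in `C^r` from convergence of bilinear forms -/

section Bilinear

variable {E H M V : Type*} [NormedAddCommGroup E] [NormedSpace ℝ E]
  [TopologicalSpace H] {I : ModelWithCorners ℝ E H} [TopologicalSpace M] [ChartedSpace H M]
  [NormedAddCommGroup V] [NormedSpace ℝ V] {r : ℕ} {Φ : M → V}

theorem ContMDiff.bilinear_prod (hΦ : ContMDiff I 𝓘(ℝ, V) r Φ) (B : V →L[ℝ] V →L[ℝ] ℝ) :
    ContMDiff (I.prod I) 𝓘(ℝ, ℝ) r (fun z : M × M => B (Φ z.1) (Φ z.2)) := by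
  have h1 : ContMDiff (I.prod I) 𝓘(ℝ, V →L[ℝ] ℝ) r (fun z : M × M => B (Φ z.1)) :=
    B.contMDiff.comp (hΦ.comp contMDiff_fst)
  exact h1.clm_apply (hΦ.comp contMDiff_snd)

/-- By the Leibniz bound for bilinear maps, the $m$-th derivative of the difference is at most
$\|B_0-B_a\|$ times a continuous function independent of $a$, which is bounded on the compact set.
-/
theorem tendstoCr_of_tendsto_bilinear [IsManifold I r M] (hΦ : ContMDiff I 𝓘(ℝ, V) r Φ)
    {α : Type*} {B : α → V →L[ℝ] V →L[ℝ] ℝ} {B₀ : V →L[ℝ] V →L[ℝ] ℝ} {l : Filter α}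
    (hB : Tendsto B l (𝓝 B₀)) :
    TendstoCr (I.prod I) r (fun a (z : M × M) => B a (Φ z.1) (Φ z.2)) l
      (fun z => B₀ (Φ z.1) (Φ z.2)) := by
  refine ⟨fun a => hΦ.bilinear_prod (B a), hΦ.bilinear_prod B₀, ?_⟩
  intro z m hm K hK hKc
  set e := extChartAt (I.prod I) z
  have hu : UniqueDiffOn ℝ e.target := uniqueDiffOn_extChartAt_target z
  have hsymm : ContMDiffOn 𝓘(ℝ, E × E) (I.prod I) r e.symm e.target :=
    contMDiffOn_extChartAt_symm z
  have hf : ContDiffOn ℝ r (fun w => Φ (e.symm w).1) e.target :=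
    ((hΦ.comp contMDiff_fst).comp_contMDiffOn hsymm).contDiffOn
  have hg : ContDiffOn ℝ r (fun w => Φ (e.symm w).2) e.target :=
    ((hΦ.comp contMDiff_snd).comp_contMDiffOn hsymm).contDiffOn
  have hBil : ∀ B' : V →L[ℝ] V →L[ℝ] ℝ,
      ContDiffOn ℝ r (fun w => B' (Φ (e.symm w).1) (Φ (e.symm w).2)) e.target := fun B' =>
    ((hΦ.bilinear_prod B').comp_contMDiffOn hsymm).contDiffOn
  have hle : ∀ i ≤ m, ((i : ℕ) : WithTop ℕ∞) ≤ r := fun i hi => by exact_mod_cast hi.trans hm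
  set S : E × E → ℝ := fun w => ∑ i ∈ Finset.range (m + 1), (m.choose i : ℝ) *
    ‖iteratedFDerivWithin ℝ i (fun w => Φ (e.symm w).1) e.target w‖ *
    ‖iteratedFDerivWithin ℝ (m - i) (fun w => Φ (e.symm w).2) e.target w‖ with hS
  have hScont : ContinuousOn S K := by
    refine continuousOn_finsetSum _ fun i hi => ?_
    have hi' : i ≤ m := Nat.lt_succ_iff.1 (Finset.mem_range.1 hi)
    exact (continuousOn_const.mul
      ((hf.continuousOn_iteratedFDerivWithin (hle i hi') hu).mono hK).norm).mul
      ((hg.continuousOn_iteratedFDerivWithin (hle (m - i) (Nat.sub_le _ _)) hu).mono hK).norm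
  obtain ⟨C, hC⟩ := hKc.exists_bound_of_continuousOn hScont
  have hlim : Tendsto (fun a => ‖B₀ - B a‖ * C) l (𝓝 0) := by
    have h := (tendsto_iff_norm_sub_tendsto_zero (E := V →L[ℝ] V →L[ℝ] ℝ)).1 hB
    simpa [norm_sub_rev B₀] using h.mul_const C
  rw [Metric.tendstoUniformlyOn_iff]
  intro ε hε
  filter_upwards [hlim.eventually (gt_mem_nhds hε)] with a ha w hw
  refine lt_of_le_of_lt ?_ ha
  rw [dist_eq_norm]
  have h1 := iteratedFDerivWithin_sub_apply (((hBil B₀) w (hK hw)).of_le (hle m le_rfl))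
    (((hBil (B a)) w (hK hw)).of_le (hle m le_rfl)) hu (hK hw)
  have h2 := (B₀ - B a).norm_iteratedFDerivWithin_le_of_bilinear hf hg hu (hK hw) (hle m le_rfl)
  have h3 : ((fun w => B₀ (Φ (e.symm w).1) (Φ (e.symm w).2)) -
      fun w => B a (Φ (e.symm w).1) (Φ (e.symm w).2)) =
      fun w => (B₀ - B a) (Φ (e.symm w).1) (Φ (e.symm w).2) := by
    ext w; simp
  rw [h3] at h1
  calc _ = _ := by rw [← sub_eq_zero]; simp only [Function.comp_def]; rw [← h1, sub_self]
    _ ≤ ‖B₀ - B a‖ * S w := h2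
    _ ≤ ‖B₀ - B a‖ * C := by
      gcongr
      exact (le_abs_self _).trans (hC w hw)

end Bilinear

/-! ### Operators that are diagonal in a Hilbert basis -/

section Diagonal

variable {ι 𝓛 : Type*} [NormedAddCommGroup 𝓛] [InnerProductSpace ℂ 𝓛]

theorem HilbertBasis.ext_inner (b : HilbertBasis ι ℂ 𝓛) {f g : 𝓛}
    (h : ∀ j, inner ℂ (b j) f = inner ℂ (b j) g) : f = g := by
  apply b.repr.injective
  ext j
  simpa [b.repr_apply_apply] using h j

theorem HilbertBasis.hasSum_norm_inner_sq (b : HilbertBasis ι ℂ 𝓛) (f : 𝓛) :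
    HasSum (fun j => ‖inner ℂ (b j) f‖ ^ 2) (‖f‖ ^ 2) := by
  have h := Complex.hasSum_re (b.hasSum_inner_mul_inner f f)
  rw [inner_self_eq_norm_sq_to_K] at h
  convert h using 1
  · ext j
    rw [← inner_conj_symm f (b j), mul_comm, Complex.mul_conj, Complex.normSq_eq_norm_sq]
    norm_cast
  · norm_cast

variable {b : HilbertBasis ι ℂ 𝓛} {T : 𝓛 →L[ℂ] 𝓛} {μ : ι → ℝ}

/-- $T$ is applied termwise to the expansion of $f$. Self-adjointness is not available at this
point; it is deduced from this formula in `isSymmetric_diagonal`. -/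
theorem inner_diagonal_apply (hT : ∀ j, T (b j) = (μ j : ℂ) • b j) (f : 𝓛) (j : ι) :
    inner ℂ (b j) (T f) = μ j * inner ℂ (b j) f := by
  classical
  have h1 : HasSum (fun i => (b.repr f i * μ i) • b i) (T f) := by
    have h := (b.hasSum_repr f).mapL T
    simp_rw [map_smul, hT, smul_smul] at h
    exact h
  have h2 := h1.mapL (innerSL ℂ (b j))
  have h3 : HasSum (fun i => if i = j then (μ j : ℂ) * inner ℂ (b j) f else 0)
      (inner ℂ (b j) (T f)) := by
    refine h2.congr_fun fun i => ?_
    rw [innerSL_apply_apply, inner_smul_right, orthonormal_iff_ite.1 b.orthonormal]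
    by_cases h : i = j
    · subst h; simp [b.repr_apply_apply, mul_comm]
    · simp [h, Ne.symm h]
  exact h3.unique (hasSum_ite_eq j _)

theorem hasSum_inner_diagonal (hT : ∀ j, T (b j) = (μ j : ℂ) • b j) (f : 𝓛) :
    HasSum (fun j => μ j * ‖inner ℂ (b j) f‖ ^ 2) (inner ℂ f (T f)).re := by
  have h := Complex.hasSum_re (b.hasSum_inner_mul_inner f (T f))
  convert h using 1
  ext j
  rw [inner_diagonal_apply hT, ← inner_conj_symm f (b j), mul_left_comm, mul_comm (starRingEnd ℂ _),
    Complex.mul_conj, Complex.normSq_eq_norm_sq]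
  norm_cast

theorem isSymmetric_diagonal (hT : ∀ j, T (b j) = (μ j : ℂ) • b j) (f g : 𝓛) :
    inner ℂ (T f) g = inner ℂ f (T g) := by
  refine (b.hasSum_inner_mul_inner (T f) g).unique ?_
  convert b.hasSum_inner_mul_inner f (T g) using 1
  ext j
  rw [← inner_conj_symm (T f), inner_diagonal_apply hT, inner_diagonal_apply hT,
    ← inner_conj_symm f (b j)]
  simp only [map_mul, Complex.conj_ofReal]
  ring

theorem isPositive_diagonal (hT : ∀ j, T (b j) = (μ j : ℂ) • b j) (hμ : ∀ j, 0 ≤ μ j) :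
    T.IsPositive := by
  refine ⟨fun f g => isSymmetric_diagonal hT f g, fun f => ?_⟩
  rw [ContinuousLinearMap.reApplyInnerSelf_apply, isSymmetric_diagonal hT]
  exact (hasSum_inner_diagonal hT f).nonneg fun j => mul_nonneg (hμ j) (by positivity)

theorem inner_diagonal_pos (hT : ∀ j, T (b j) = (μ j : ℂ) • b j) (hμ : ∀ j, 0 < μ j)
    {f : 𝓛} (hf : f ≠ 0) : 0 < (inner ℂ f (T f)).re := by
  have hs := hasSum_inner_diagonal hT f
  obtain ⟨j, hj⟩ : ∃ j, inner ℂ (b j) f ≠ 0 := by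
    by_contra! h
    exact hf (b.ext_inner fun j => by rw [h j, inner_zero_right])
  rw [← hs.tsum_eq]
  exact hs.summable.tsum_pos (fun i => mul_nonneg (hμ i).le (by positivity)) j
    (mul_pos (hμ j) (by positivity))

theorem diagonal_apply_eq_self_iff (hT : ∀ j, T (b j) = (μ j : ℂ) • b j) (f : 𝓛) :
    T f = f ↔ ∀ j, μ j = 1 ∨ inner ℂ (b j) f = 0 := by
  constructor
  · intro h j
    have h1 := inner_diagonal_apply hT f j
    rw [h] at h1
    by_cases h0 : inner ℂ (b j) f = 0
    · exact Or.inr h0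
    · left
      have := mul_right_cancel₀ h0 ((one_mul _).trans h1)
      exact_mod_cast this.symm
  · intro h
    refine b.ext_inner fun j => ?_
    rw [inner_diagonal_apply hT]
    rcases h j with h | h <;> simp [h]

theorem norm_sq_diagonal_sub {S : 𝓛 →L[ℂ] 𝓛} {η : ι → ℝ} (hT : ∀ j, T (b j) = (μ j : ℂ) • b j)
    (hS : ∀ j, S (b j) = (η j : ℂ) • b j) (f : 𝓛) :
    ‖T f - S f‖ ^ 2 = ∑' j, (μ j - η j) ^ 2 * ‖inner ℂ (b j) f‖ ^ 2 := by
  rw [← (b.hasSum_norm_inner_sq (T f - S f)).tsum_eq]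
  congr 1
  ext j
  rw [inner_sub_right, inner_diagonal_apply hT, inner_diagonal_apply hS, ← sub_mul, norm_mul,
    mul_pow, ← Complex.ofReal_sub, Complex.norm_real, Real.norm_eq_abs, sq_abs]

/-- Dominated convergence in Parseval's identity. The $a_j$ may be unbounded below, but $a_j\le1$
bounds all the exponentials by $e^{t_0+1}$ for $t<t_0+1$. -/
theorem continuous_diagonal_semigroup {T : ℝ≥0 → 𝓛 →L[ℂ] 𝓛} {a : ι → ℝ} (ha : ∀ j, a j ≤ 1)
    (hT : ∀ t j, T t (b j) = ((Real.exp (t * a j) : ℝ) : ℂ) • b j) (f : 𝓛) :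
    Continuous fun t => T t f := by
  rw [continuous_iff_continuousAt]
  intro t₀
  have hexp : ∀ (t : ℝ≥0) j, Real.exp (t * a j) ≤ Real.exp t := fun t j =>
    Real.exp_le_exp.2 (mul_le_of_le_one_right t.2 (ha j))
  have hsq : Tendsto (fun t => ‖T t f - T t₀ f‖ ^ 2) (𝓝 t₀) (𝓝 0) := by
    simp_rw [norm_sq_diagonal_sub (hT _) (hT t₀)]
    rw [← tsum_zero (α := ℝ) (β := ι)]
    refine tendsto_tsum_of_dominated_convergence
      (bound := fun j => (Real.exp (t₀ + 1)) ^ 2 * ‖inner ℂ (b j) f‖ ^ 2)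
      ((b.hasSum_norm_inner_sq f).summable.mul_left _) (fun j => ?_) ?_
    · have h1 : Continuous fun t : ℝ≥0 =>
          (Real.exp (t * a j) - Real.exp (t₀ * a j)) ^ 2 * ‖inner ℂ (b j) f‖ ^ 2 := by fun_prop
      simpa using h1.tendsto t₀
    · filter_upwards [gt_mem_nhds (lt_add_one t₀)] with t ht j
      rw [Real.norm_of_nonneg (by positivity)]
      refine mul_le_mul_of_nonneg_right ?_ (by positivity)
      refine sq_le_sq' ?_ ?_
      · have h2 : Real.exp t₀ ≤ Real.exp (t₀ + 1) := Real.exp_le_exp.2 (by linarith)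
        linarith [hexp t₀ j, Real.exp_pos (t * a j)]
      · have h2 : Real.exp t ≤ Real.exp (t₀ + 1) := Real.exp_le_exp.2 (by exact_mod_cast ht.le)
        linarith [hexp t j, Real.exp_pos (t₀ * a j)]
  have hnorm : Tendsto (fun t => ‖T t f - T t₀ f‖) (𝓝 t₀) (𝓝 0) := by
    have := (Real.continuous_sqrt.tendsto 0).comp hsq
    simpa [Function.comp_def, Real.sqrt_sq (norm_nonneg _)] using this
  exact tendsto_iff_norm_sub_tendsto_zero.2 hnorm

end Diagonal

/-! ### Reproducing kernel Hilbert spaces of continuous kernels -/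

section RKHSEmbedding

theorem Orthonormal.summable_smul {ι 𝓗 : Type*} [NormedAddCommGroup 𝓗] [InnerProductSpace ℂ 𝓗]
    [CompleteSpace 𝓗] {e : ι → 𝓗} (he : Orthonormal ℂ e) {c : ι → ℂ}
    (hc : Summable fun j => ‖c j‖ ^ 2) : Summable fun j => c j • e j := by
  have h := he.orthogonalFamily.summable_iff_norm_sq_summable c
  simpa using h.2 hc

theorem hasSum_rkhs_apply {ι X 𝓗 : Type*} [NormedAddCommGroup 𝓗] [InnerProductSpace ℂ 𝓗]
    [RKHS ℂ 𝓗 X ℂ] {c : ι → ℂ} {e : ι → 𝓗} {f : 𝓗} (h : HasSum (fun j => c j • e j) f) (x : X) :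
    HasSum (fun j => c j * e j x) (f x) := by
  have h1 := h.mapL (ContinuousLinearMap.proj (R := ℂ) (φ := fun _ : X => ℂ) x ∘L RKHS.coeCLM ℂ)
  simpa using h1

/-- Bounded weights keep the coefficients of $f$ square-summable, so the same series converges in
$\mathcal H_1$. Evaluations are continuous in both spaces, hence the two sums agree pointwise. -/
theorem rkhsFunctions_subset {ι X 𝓗₁ 𝓗₂ : Type*} [NormedAddCommGroup 𝓗₁]
    [InnerProductSpace ℂ 𝓗₁] [CompleteSpace 𝓗₁] [RKHS ℂ 𝓗₁ X ℂ] [NormedAddCommGroup 𝓗₂]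
    [InnerProductSpace ℂ 𝓗₂] [RKHS ℂ 𝓗₂ X ℂ] (b : HilbertBasis ι ℂ 𝓗₂) {e : ι → 𝓗₁}
    (he : Orthonormal ℂ e) {w : ι → ℝ} {C : ℝ} (hw : ∀ j, |w j| ≤ C)
    (hb : ∀ j x, b j x = w j * e j x) : rkhsFunctions (M := X) 𝓗₂ ⊆ rkhsFunctions (M := X) 𝓗₁ := by
  rintro _ ⟨f, rfl⟩
  have hs : Summable fun j => ‖b.repr f j * w j‖ ^ 2 := by
    refine Summable.of_nonneg_of_le (fun j => by positivity) (fun j => ?_)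
      ((b.hasSum_norm_inner_sq f).summable.mul_left (C ^ 2))
    rw [b.repr_apply_apply, norm_mul, mul_pow, mul_comm, Complex.norm_real, Real.norm_eq_abs]
    gcongr
    exact hw j
  obtain ⟨g, hg⟩ := he.summable_smul hs
  refine ⟨g, funext fun x => ?_⟩
  refine (hasSum_rkhs_apply hg x).unique ?_
  refine (hasSum_rkhs_apply (b.hasSum_repr f) x).congr_fun fun j => ?_
  rw [hb, mul_assoc]

/-- The kernel expansion puts every kernel function in the closed span of the $e_j$. A vector
orthogonal to all $e_j$ is then orthogonal to the kernel functions, that is, it vanishes at every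
point. -/
theorem exists_hilbertBasis_of_hasSum {X ι 𝓗 : Type*} [NormedAddCommGroup 𝓗]
    [InnerProductSpace ℂ 𝓗] [CompleteSpace 𝓗] [RKHS ℂ 𝓗 X ℂ] {e : ι → 𝓗}
    (he : Orthonormal ℂ e)
    (hsum : ∀ x y : X, HasSum (fun j => starRingEnd ℂ (e j x) * e j y) (RKHS.kernel 𝓗 y x 1)) :
    ∃ b : HilbertBasis ι ℂ 𝓗, ∀ j, b j = e j := by
  have hker : ∀ x : X, HasSum (fun j => starRingEnd ℂ (e j x) • e j) (RKHS.kerFun 𝓗 x (1 : ℂ)) := by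
    intro x
    have hs : Summable fun j => ‖starRingEnd ℂ (e j x)‖ ^ 2 := by
      refine (Complex.hasSum_re (hsum x x)).summable.congr fun j => ?_
      rw [mul_comm, Complex.mul_conj, Complex.normSq_eq_norm_sq, RCLike.norm_conj]
      norm_cast
    obtain ⟨g, hg⟩ := he.summable_smul hs
    convert hg
    refine RKHS.ext (X := X) fun y => ?_
    rw [RKHS.kerFun_apply]
    exact (hsum x y).unique (hasSum_rkhs_apply hg y)
  have hbot : (Submodule.span ℂ (Set.range e))ᗮ = ⊥ := by
    rw [Submodule.eq_bot_iff]
    intro f hf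
    refine RKHS.ext (X := X) fun x => ?_
    have h1 : HasSum (fun _ : ι => (0 : ℂ)) (inner ℂ f (RKHS.kerFun 𝓗 x (1 : ℂ))) := by
      refine ((hker x).mapL (innerSL ℂ f)).congr_fun fun j => ?_
      have hj : e j ∈ Submodule.span ℂ (Set.range e) := Submodule.subset_span ⟨j, rfl⟩
      rw [innerSL_apply_apply, inner_smul_right, Submodule.inner_left_of_mem_orthogonal hj hf,
        mul_zero]
    have h2 := h1.unique hasSum_zero
    rw [inner_eq_zero_symm] at h2
    simpa using h2
  exact ⟨HilbertBasis.mkOfOrthogonalEqBot he hbot, fun j => by simp⟩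

theorem rkhs_apply_eq_inner {X 𝓗 : Type*} [NormedAddCommGroup 𝓗] [InnerProductSpace ℂ 𝓗]
    [CompleteSpace 𝓗] [RKHS ℂ 𝓗 X ℂ] (f : 𝓗) (x : X) :
    f x = inner ℂ (RKHS.kerFun 𝓗 x 1) f := by
  simp

variable {M : Type*} [TopologicalSpace M] {k : C(M × M, ℝ)}
  {𝓗 : Type*} [NormedAddCommGroup 𝓗] [InnerProductSpace ℂ 𝓗] [CompleteSpace 𝓗] [RKHS ℂ 𝓗 M ℂ]

theorem HasReproducingKernel.inner_kerFun (h : HasReproducingKernel 𝓗 k) (x y : M) :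
    inner ℂ (RKHS.kerFun 𝓗 x (1 : ℂ)) (RKHS.kerFun 𝓗 y (1 : ℂ)) = (k (x, y) : ℂ) := by
  rw [← rkhs_apply_eq_inner, RKHS.kerFun_apply, h x y]

theorem HasReproducingKernel.continuous_kerFun (h : HasReproducingKernel 𝓗 k) :
    Continuous fun x : M => RKHS.kerFun 𝓗 x (1 : ℂ) := by
  rw [continuous_iff_continuousAt]
  intro x₀
  have hsq : ∀ x, ‖RKHS.kerFun 𝓗 x (1 : ℂ) - RKHS.kerFun 𝓗 x₀ (1 : ℂ)‖ =
      √(k (x, x) - 2 * k (x, x₀) + k (x₀, x₀)) := fun x => by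
    have h1 := norm_sub_sq (𝕜 := ℂ) (RKHS.kerFun 𝓗 x (1 : ℂ)) (RKHS.kerFun 𝓗 x₀ (1 : ℂ))
    rw [norm_sq_eq_re_inner (𝕜 := ℂ) (RKHS.kerFun 𝓗 x (1 : ℂ)),
      norm_sq_eq_re_inner (𝕜 := ℂ) (RKHS.kerFun 𝓗 x₀ (1 : ℂ)), h.inner_kerFun, h.inner_kerFun,
      h.inner_kerFun] at h1
    rw [← Real.sqrt_sq (norm_nonneg (RKHS.kerFun 𝓗 x (1 : ℂ) - RKHS.kerFun 𝓗 x₀ (1 : ℂ))), h1]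
    simp
  refine tendsto_iff_norm_sub_tendsto_zero.2 ?_
  simp_rw [hsq]
  have hc : Continuous fun x => √(k (x, x) - 2 * k (x, x₀) + k (x₀, x₀)) := by fun_prop
  convert hc.tendsto x₀ using 2
  ring_nf
  simp

variable [CompactSpace M]

/-- The inclusion of a reproducing kernel Hilbert space with continuous kernel into `C⁰(M)`. -/
def rkhsToContinuousMap (h : HasReproducingKernel 𝓗 k) : 𝓗 →L[ℂ] C(M, ℂ) :=
  LinearMap.mkContinuous
    { toFun := fun f =>
        { toFun := f
          continuous_toFun := by
            have h1 := h.continuous_kerFun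
            have h2 : Continuous fun x => inner ℂ (RKHS.kerFun 𝓗 x (1 : ℂ)) f := by fun_prop
            exact h2.congr fun x => (rkhs_apply_eq_inner f x).symm }
      map_add' := fun f g => by ext x; simp
      map_smul' := fun c f => by ext x; simp }
    ‖(⟨fun x => RKHS.kerFun 𝓗 x (1 : ℂ), h.continuous_kerFun⟩ : C(M, 𝓗))‖
    (fun f => by
      rw [ContinuousMap.norm_le _ (by positivity)]
      intro x
      change ‖f x‖ ≤ _
      rw [rkhs_apply_eq_inner]
      exact (norm_inner_le_norm _ _).trans (mul_le_mul_of_nonneg_right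
        (ContinuousMap.norm_coe_le_norm
          (⟨fun x => RKHS.kerFun 𝓗 x (1 : ℂ), h.continuous_kerFun⟩ : C(M, 𝓗)) x) (norm_nonneg _)))

variable [MeasurableSpace M] [BorelSpace M] (ν : Measure M) [IsFiniteMeasure ν]

/-- The map taking an element of the reproducing kernel Hilbert space to its class in `L²(ν)`. -/
def rkhsToL2 (h : HasReproducingKernel 𝓗 k) : 𝓗 →L[ℂ] Lp ℂ 2 ν :=
  (ContinuousMap.toLp 2 ν ℂ) ∘L (rkhsToContinuousMap h)

theorem coeFn_rkhsToL2 (h : HasReproducingKernel 𝓗 k) (f : 𝓗) :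
    rkhsToL2 ν h f =ᵐ[ν] f :=
  ContinuousMap.coeFn_toLp (p := 2) (𝕜 := ℂ) ν (rkhsToContinuousMap h f)

theorem rkhsToL2_kerFun (h : HasReproducingKernel 𝓗 k) (hk : IsSymmKernel k) (x : M) :
    rkhsToL2 ν h (RKHS.kerFun 𝓗 x (1 : ℂ)) = kernelSection k ν x := by
  change ContinuousMap.toLp 2 ν ℂ _ = ContinuousMap.toLp 2 ν ℂ _
  congr 1
  ext y
  change RKHS.kerFun 𝓗 x (1 : ℂ) y = (k (x, y) : ℂ)
  rw [RKHS.kerFun_apply, h y x, hk]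

theorem adjoint_rkhsToL2_apply (h : HasReproducingKernel 𝓗 k) (hk : IsSymmKernel k)
    (f : Lp ℂ 2 ν) (x : M) :
    (rkhsToL2 ν h).adjoint f x = ∫ y, (k (x, y) : ℂ) * f y ∂ν := by
  rw [rkhs_apply_eq_inner, ContinuousLinearMap.adjoint_inner_right, rkhsToL2_kerFun ν h hk,
    integral_kernel_eq_inner]

theorem rkhsToL2_comp_adjoint (h : HasReproducingKernel 𝓗 k) (hk : IsSymmKernel k) :
    rkhsToL2 ν h ∘L (rkhsToL2 ν h).adjoint = kernelOp k ν := by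
  ext1 f
  change ContinuousMap.toLp 2 ν ℂ _ = ContinuousMap.toLp 2 ν ℂ _
  congr 1
  ext x
  exact adjoint_rkhsToL2_apply ν h hk f x

variable {ν} {ι : Type*} {φ : HilbertBasis ι ℂ (Lp ℂ 2 ν)} {μ : ι → ℝ}

/-- The orthonormal functions `μ^{-1/2} K φ` in the reproducing kernel Hilbert space. -/
def rkhsEigenfunction (h : HasReproducingKernel 𝓗 k) (φ : HilbertBasis ι ℂ (Lp ℂ 2 ν))
    (μ : ι → ℝ) (j : ι) : 𝓗 :=
  (((√(μ j))⁻¹ : ℝ) : ℂ) • (rkhsToL2 ν h).adjoint (φ j)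

theorem rkhsEigenfunction_apply (h : HasReproducingKernel 𝓗 k) (hk : IsSymmKernel k)
    (j : ι) (x : M) :
    rkhsEigenfunction h φ μ j x = (((√(μ j))⁻¹ : ℝ) : ℂ) * kernelInt k ν (φ j) x := by
  rw [rkhsEigenfunction, RKHS.coe_smul, Pi.smul_apply, adjoint_rkhsToL2_apply ν h hk,
    kernelInt_apply, smul_eq_mul]

/-- $\langle R^*\phi_i,R^*\phi_j\rangle=\langle\phi_i,RR^*\phi_j\rangle=\mu_j\delta_{ij}$, where $R$
is `rkhsToL2`. -/
theorem orthonormal_rkhsEigenfunction (h : HasReproducingKernel 𝓗 k) (hk : IsSymmKernel k)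
    (hμ : ∀ j, 0 < μ j) (hφ : ∀ j, kernelOp k ν (φ j) = (μ j : ℂ) • φ j) :
    Orthonormal ℂ (rkhsEigenfunction h φ μ) := by
  classical
  rw [orthonormal_iff_ite]
  intro i j
  rw [rkhsEigenfunction, rkhsEigenfunction, inner_smul_left, inner_smul_right,
    ContinuousLinearMap.adjoint_inner_left, ← ContinuousLinearMap.comp_apply,
    rkhsToL2_comp_adjoint ν h hk, hφ, inner_smul_right, orthonormal_iff_ite.1 φ.orthonormal]
  split_ifs with hij
  · subst hij
    rw [Complex.conj_ofReal]
    norm_cast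
    have := Real.mul_self_sqrt (hμ i).le
    have h0 : √(μ i) ≠ 0 := (Real.sqrt_pos.2 (hμ i)).ne'
    field_simp
    rw [sq, this]
  · simp

/-- Each $\phi_j=R(\mu_j^{-1}R^*\phi_j)$ lies in the range of the inclusion $R$. -/
theorem isDenseInL2_of_eigenbasis (h : HasReproducingKernel 𝓗 k) (hk : IsSymmKernel k)
    (hμ : ∀ j, 0 < μ j) (hφ : ∀ j, kernelOp k ν (φ j) = (μ j : ℂ) • φ j) :
    IsDenseInL2 𝓗 ν := by
  refine ⟨?_, ?_⟩
  · rintro _ ⟨f, rfl⟩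
    exact (Lp.memLp (rkhsToL2 ν h f)).ae_eq (coeFn_rkhsToL2 ν h f)
  · have hd : Dense (LinearMap.range (rkhsToL2 ν h).toLinearMap : Set (Lp ℂ 2 ν)) := by
      have h1 := φ.dense_span
      have h2 : Submodule.span ℂ (Set.range φ) ≤ LinearMap.range (rkhsToL2 ν h).toLinearMap := by
        rw [Submodule.span_le]
        rintro _ ⟨j, rfl⟩
        refine ⟨((μ j : ℂ))⁻¹ • (rkhsToL2 ν h).adjoint (φ j), ?_⟩
        have h3 : rkhsToL2 ν h ((rkhsToL2 ν h).adjoint (φ j)) = (μ j : ℂ) • φ j := by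
          rw [← hφ, ← rkhsToL2_comp_adjoint ν h hk, ContinuousLinearMap.comp_apply]
        have h0 : (μ j : ℂ) ≠ 0 := by exact_mod_cast (hμ j).ne'
        simp only [ContinuousLinearMap.coe_coe, map_smul]
        rw [h3, inv_smul_smul₀ h0]
      exact (Submodule.dense_iff_topologicalClosure_eq_top.2 h1).mono h2
    refine hd.mono ?_
    rintro _ ⟨f, rfl⟩
    exact ⟨f, ⟨f, rfl⟩, coeFn_rkhsToL2 ν h f⟩

end RKHSEmbedding

/-! ### The kernels `p_τ` -/

section SumForm

variable {ι V : Type*} [NormedAddCommGroup V] [NormedSpace ℝ V]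

theorem summable_smul_of_norm_le_one [CompleteSpace V] {c : ι → ℝ} (hc : Summable c)
    (hc0 : ∀ j, 0 ≤ c j) {B : ι → V} (hB : ∀ j, ‖B j‖ ≤ 1) : Summable fun j => c j • B j := by
  refine Summable.of_norm_bounded hc fun j => ?_
  rw [norm_smul, Real.norm_of_nonneg (hc0 j)]
  exact mul_le_of_le_one_right (hc0 j) (hB j)

/-- The form `(u, v) ↦ ∑ c_j ℓ_j(u) ℓ_j(v)`. -/
def sumForm (c : ι → ℝ) (ℓ : ι → V →L[ℝ] ℝ) : V →L[ℝ] V →L[ℝ] ℝ :=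
  ∑' j, c j • (ℓ j).smulRight (ℓ j)

theorem hasSum_sumForm {c : ι → ℝ} (hc : Summable c) (hc0 : ∀ j, 0 ≤ c j) {ℓ : ι → V →L[ℝ] ℝ}
    (hℓ : ∀ j, ‖ℓ j‖ ≤ 1) : HasSum (fun j => c j • (ℓ j).smulRight (ℓ j)) (sumForm c ℓ) := by
  refine (summable_smul_of_norm_le_one hc hc0
    (B := fun j => (ℓ j).smulRight (ℓ j)) fun j => ?_).hasSum
  rw [ContinuousLinearMap.norm_smulRight_apply]
  exact mul_le_one₀ (hℓ j) (norm_nonneg _) (hℓ j)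

theorem hasSum_sumForm_apply {c : ι → ℝ} (hc : Summable c) (hc0 : ∀ j, 0 ≤ c j)
    {ℓ : ι → V →L[ℝ] ℝ} (hℓ : ∀ j, ‖ℓ j‖ ≤ 1) (u : V) :
    HasSum (fun j => (c j * ℓ j u) • ℓ j) (sumForm c ℓ u) := by
  refine ((hasSum_sumForm hc hc0 hℓ).mapL
    (ContinuousLinearMap.apply ℝ (V →L[ℝ] ℝ) u)).congr_fun fun j => ?_
  simp [mul_smul]

variable {𝓛 : Type*} [NormedAddCommGroup 𝓛] [InnerProductSpace ℂ 𝓛] [NormedSpace ℝ 𝓛]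
  [IsScalarTower ℝ ℂ 𝓛]

/-- The functional `u ↦ Re ⟨f, u⟩`. -/
def reInner (f : 𝓛) : 𝓛 →L[ℝ] ℝ :=
  Complex.reCLM ∘L ((innerSL ℂ f).restrictScalars ℝ)

theorem norm_reInner_le (f : 𝓛) : ‖reInner f‖ ≤ ‖f‖ :=
  ContinuousLinearMap.opNorm_le_bound _ (norm_nonneg _) fun u =>
    (Complex.abs_re_le_norm _).trans (norm_inner_le_norm f u)

end SumForm

/-! ### Kernels $\sum_j c_j\,K\phi_j\otimes K\phi_j$ and their action on the eigenbasis -/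

section KernelExpansion

variable {M : Type*} [TopologicalSpace M] [CompactSpace M] [MeasurableSpace M] [BorelSpace M]
  (ν : Measure M) [IsFiniteMeasure ν]

/-- Real continuous functions, complexified, as elements of `L²(ν)`. -/
def realToLp : C(M, ℝ) →L[ℝ] Lp ℂ 2 ν :=
  ((ContinuousMap.toLp 2 ν ℂ).restrictScalars ℝ) ∘L
    (Complex.ofRealCLM.compLeftContinuous ℝ M)

theorem coeFn_realToLp (h : C(M, ℝ)) : realToLp ν h =ᵐ[ν] fun y => (h y : ℂ) :=
  ContinuousMap.coeFn_toLp (p := 2) (𝕜 := ℂ) ν (Complex.ofRealCLM.compLeftContinuous ℝ M h)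

theorem realToLp_curry (k : C(M × M, ℝ)) (x : M) :
    realToLp ν (k.curry x) = kernelSection k ν x := rfl

theorem inner_realToLp (g h : C(M, ℝ)) :
    inner ℂ (realToLp ν g) (realToLp ν h) = ((∫ y, g y * h y ∂ν : ℝ) : ℂ) := by
  rw [L2.inner_def, ← integral_complex_ofReal]
  refine integral_congr_ae ?_
  filter_upwards [coeFn_realToLp ν g, coeFn_realToLp ν h] with y h1 h2
  rw [h1, h2]
  simp [mul_comm]

variable {ν}

/-- The functional `h ↦ ∫ h f dν`. -/
def pairing (f : Lp ℂ 2 ν) : C(M, ℝ) →L[ℝ] ℂ :=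
  (Complex.conjCLE : ℂ →L[ℝ] ℂ) ∘L ((innerSL ℂ f).restrictScalars ℝ) ∘L realToLp ν

theorem pairing_apply (f : Lp ℂ 2 ν) (h : C(M, ℝ)) :
    pairing f h = inner ℂ (realToLp ν h) f := by
  rw [← inner_conj_symm]
  rfl

theorem kernelInt_eq_pairing (k : C(M × M, ℝ)) (f : Lp ℂ 2 ν) (x : M) :
    kernelInt k ν f x = pairing f (k.curry x) := by
  rw [kernelInt_apply, integral_kernel_eq_inner, pairing_apply, realToLp_curry]

theorem kernelInt_eq_ofReal_re (k : C(M × M, ℝ)) {f : Lp ℂ 2 ν} (hf : ∀ᵐ x ∂ν, (f x).im = 0)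
    (x : M) : kernelInt k ν f x = ((kernelInt k ν f x).re : ℂ) := by
  refine (Complex.conj_eq_iff_re.1 ?_).symm
  rw [kernelInt_apply, ← integral_conj]
  refine integral_congr_ae ?_
  filter_upwards [hf] with y hy
  rw [map_mul, Complex.conj_ofReal, Complex.conj_eq_iff_im.2 hy]

theorem reInner_kernelSection (k : C(M × M, ℝ)) (f : Lp ℂ 2 ν) (x : M) :
    reInner f (kernelSection k ν x) = (kernelInt k ν f x).re := by
  rw [kernelInt_apply, integral_kernel_eq_inner, ← inner_conj_symm, Complex.conj_re]
  rfl

/-- The real part of `K f`, as a continuous function. -/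
def reKernelInt (k : C(M × M, ℝ)) (f : Lp ℂ 2 ν) : C(M, ℝ) :=
  ⟨fun x => (kernelInt k ν f x).re, by fun_prop⟩

@[simp]
theorem reKernelInt_apply (k : C(M × M, ℝ)) (f : Lp ℂ 2 ν) (x : M) :
    reKernelInt k f x = (kernelInt k ν f x).re := rfl

theorem realToLp_reKernelInt (k : C(M × M, ℝ)) {f : Lp ℂ 2 ν} (hf : ∀ᵐ x ∂ν, (f x).im = 0) :
    realToLp ν (reKernelInt k f) = kernelOp k ν f := by
  change ContinuousMap.toLp 2 ν ℂ _ = ContinuousMap.toLp 2 ν ℂ _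
  congr 1
  ext x
  exact (kernelInt_eq_ofReal_re k hf x).symm

variable {ι : Type*}

/-- The kernel `∑ c_j Kφ_j(x) Kφ_j(y)`. -/
def sumKernel (p : C(M × M, ℝ)) (c : ι → ℝ) (φ : ι → Lp ℂ 2 ν) : C(M × M, ℝ) :=
  ⟨fun z => sumForm c (fun j => reInner (φ j)) (kernelSection p ν z.1) (kernelSection p ν z.2), by fun_prop⟩

/-- Restriction of functionals on `L²(ν)` to the kernel sections. -/
def evalSections (p : C(M × M, ℝ)) (ν : Measure M) [IsFiniteMeasure ν] :
    (Lp ℂ 2 ν →L[ℝ] ℝ) →L[ℝ] C(M, ℝ) :=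
  flipCLM ⟨fun y => ContinuousLinearMap.apply ℝ ℝ (kernelSection p ν y),
    (ContinuousLinearMap.apply ℝ ℝ).continuous.comp (kernelSection p ν).continuous⟩

/-- For fixed $x$ the series converges in $C(M)$, not only pointwise in $y$; this allows integration
against $\phi_i$ term by term. -/
theorem hasSum_sumKernel_curry (p : C(M × M, ℝ)) {c : ι → ℝ} (hc : Summable c)
    (hc0 : ∀ j, 0 ≤ c j) {φ : ι → Lp ℂ 2 ν} (hφ : ∀ j, ‖φ j‖ = 1) (x : M) :
    HasSum (fun j => (c j * (kernelInt p ν (φ j) x).re) • reKernelInt p (φ j))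
      ((sumKernel p c φ).curry x) := by
  have h1 : HasSum _ ((sumKernel p c φ).curry x) := (hasSum_sumForm_apply hc hc0
    (fun j => (norm_reInner_le (φ j)).trans_eq (hφ j)) (kernelSection p ν x)).mapL
      (evalSections p ν)
  refine h1.congr_fun fun j => ?_
  ext y
  change _ = ((c j * reInner (φ j) (kernelSection p ν x)) • reInner (φ j)) (kernelSection p ν y)
  simp [reInner_kernelSection]

theorem hasSum_sumKernel (p : C(M × M, ℝ)) {c : ι → ℝ} (hc : Summable c)
    (hc0 : ∀ j, 0 ≤ c j) {φ : ι → Lp ℂ 2 ν} (hφ : ∀ j, ‖φ j‖ = 1) (x y : M) :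
    HasSum (fun j => c j * ((kernelInt p ν (φ j) x).re * (kernelInt p ν (φ j) y).re))
      (sumKernel p c φ (x, y)) := by
  refine ((hasSum_sumKernel_curry p hc hc0 hφ x).mapL
    (ContinuousMap.evalCLM ℝ y)).congr_fun fun j => ?_
  simp [mul_assoc]

theorem isPosDefKernel_sumKernel (p : C(M × M, ℝ)) {c : ι → ℝ} (hc : Summable c)
    (hc0 : ∀ j, 0 ≤ c j) {φ : ι → Lp ℂ 2 ν} (hφ : ∀ j, ‖φ j‖ = 1) :
    IsPosDefKernel (sumKernel p c φ) := by
  intro n x _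
  refine .of_dotProduct_mulVec_nonneg ?_ fun v => ?_
  · ext i j
    rw [Matrix.conjTranspose_apply, Matrix.of_apply, Matrix.of_apply, star_trivial]
    refine (hasSum_sumKernel p hc hc0 hφ _ _).unique ?_
    exact (hasSum_sumKernel p hc hc0 hφ _ _).congr_fun fun l => by ring
  · have h : HasSum (fun l => c l * (∑ i, v i * (kernelInt p ν (φ l) (x i)).re) ^ 2)
        (∑ i, ∑ j, v i * v j * sumKernel p c φ (x i, x j)) := by
      refine (hasSum_sum fun i _ => hasSum_sum fun j _ =>
        (hasSum_sumKernel p hc hc0 hφ (x i) (x j)).mul_left (v i * v j)).congr_fun fun l => ?_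
      rw [sq, Finset.sum_mul_sum, Finset.mul_sum]
      refine Finset.sum_congr rfl fun i _ => ?_
      rw [Finset.mul_sum]
      exact Finset.sum_congr rfl fun j _ => by ring
    have h0 := h.nonneg fun l => mul_nonneg (hc0 l) (sq_nonneg _)
    convert h0 using 1
    simp only [dotProduct, Matrix.mulVec, Finset.mul_sum, Matrix.of_apply, star_trivial]
    exact Finset.sum_congr rfl fun i _ => Finset.sum_congr rfl fun j _ => by ring

variable {p : C(M × M, ℝ)} {φ : HilbertBasis ι ℂ (Lp ℂ 2 ν)} {lam : ι → ℝ}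

/-- Pairing the series with $\phi_i$ in the second variable leaves one term, since $K\phi_j$
represents $\lambda_j\phi_j$ in $L^2(\nu)$. -/
theorem kernelInt_sumKernel {c : ι → ℝ} (hc : Summable c) (hc0 : ∀ j, 0 ≤ c j)
    (hφ_real : ∀ j, ∀ᵐ x ∂ν, (φ j x).im = 0)
    (hφ : ∀ j, kernelOp p ν (φ j) = (lam j : ℂ) • φ j) (i : ι) :
    kernelInt (sumKernel p c φ) ν (φ i) = ((c i * lam i : ℝ) : ℂ) • kernelInt p ν (φ i) := by
  classical
  ext x
  have h1 := (hasSum_sumKernel_curry p hc hc0 φ.orthonormal.1 x).mapL (pairing (φ i))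
  rw [← kernelInt_eq_pairing] at h1
  refine h1.unique ?_
  have h2 := hasSum_ite_eq i (((c i * lam i : ℝ) : ℂ) * kernelInt p ν (φ i) x)
  refine h2.congr_fun fun j => ?_
  rw [map_smul, pairing_apply, realToLp_reKernelInt p (hφ_real j), hφ, inner_smul_left,
    orthonormal_iff_ite.1 φ.orthonormal]
  split_ifs with hji
  · subst hji
    rw [kernelInt_eq_ofReal_re p (hφ_real j) x]
    simp
    ring
  · simp

theorem kernelOp_sumKernel {c : ι → ℝ} (hc : Summable c) (hc0 : ∀ j, 0 ≤ c j)
    (hφ_real : ∀ j, ∀ᵐ x ∂ν, (φ j x).im = 0)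
    (hφ : ∀ j, kernelOp p ν (φ j) = (lam j : ℂ) • φ j) (i : ι) :
    kernelOp (sumKernel p c φ) ν (φ i) = ((c i * lam i ^ 2 : ℝ) : ℂ) • φ i := by
  have h : kernelOp (sumKernel p c φ) ν (φ i) = ((c i * lam i : ℝ) : ℂ) • kernelOp p ν (φ i) := by
    simp only [kernelOp, ContinuousLinearMap.comp_apply]
    rw [kernelInt_sumKernel hc hc0 hφ_real hφ, map_smul]
  rw [h, hφ, smul_smul]
  congr 1
  push_cast
  ring

/-- $\lambda_j^2=\int (K\phi_j)^2\,d\nu$, and Bessel's inequality for $k_x$ bounds every finite sum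
of the integrands by $\|k_x\|^2$, which is bounded in $x$. -/
theorem summable_eigenvalue_sq (hφ_real : ∀ j, ∀ᵐ x ∂ν, (φ j x).im = 0)
    (hφ : ∀ j, kernelOp p ν (φ j) = (lam j : ℂ) • φ j) : Summable fun j => lam j ^ 2 := by
  have hsq : ∀ j, lam j ^ 2 = ∫ x, (kernelInt p ν (φ j) x).re ^ 2 ∂ν := fun j => by
    have h := inner_realToLp ν (reKernelInt p (φ j)) (reKernelInt p (φ j))
    rw [realToLp_reKernelInt p (hφ_real j), hφ, inner_smul_left, inner_smul_right,
      inner_self_eq_norm_sq_to_K, φ.orthonormal.1 j, Complex.conj_ofReal] at h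
    have h' : lam j * lam j = ∫ x, (kernelInt p ν (φ j) x).re * (kernelInt p ν (φ j) x).re ∂ν := by
      simp only [Complex.coe_algebraMap, Complex.ofReal_one, one_pow, mul_one] at h
      exact_mod_cast h
    simp_rw [sq]
    exact h'
  have hint : ∀ f : C(M, ℝ), Integrable f ν := fun f =>
    f.continuous.integrable_of_hasCompactSupport (HasCompactSupport.of_compactSpace f)
  refine summable_of_sum_le (fun j => sq_nonneg _)
    (c := ∫ _, ‖kernelSection p ν‖ ^ 2 ∂ν) fun s => ?_
  simp_rw [hsq]
  have hint' : ∀ j ∈ s, Integrable (fun x => (kernelInt p ν (φ j) x).re ^ 2) ν := fun j _ =>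
    hint (reKernelInt p (φ j) ^ 2)
  rw [← integral_finsetSum s hint']
  refine integral_mono (integrable_finsetSum s hint')
    (integrable_const _) fun x => ?_
  calc ∑ j ∈ s, (kernelInt p ν (φ j) x).re ^ 2
      ≤ ∑ j ∈ s, ‖inner ℂ (φ j) (kernelSection p ν x)‖ ^ 2 := by
        refine Finset.sum_le_sum fun j _ => ?_
        rw [kernelInt_apply, integral_kernel_eq_inner, norm_inner_symm, ← sq_abs]
        gcongr
        exact Complex.abs_re_le_norm _
    _ ≤ ‖kernelSection p ν x‖ ^ 2 := φ.orthonormal.sum_inner_products_le _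
    _ ≤ ‖kernelSection p ν‖ ^ 2 := by
        gcongr
        exact ContinuousMap.norm_coe_le_norm _ x

end KernelExpansion

/-! ### The eigenvalues `λ_τ` -/

section EigTau

theorem eigTau_pos (τ l : ℝ) : 0 < eigTau τ l := Real.exp_pos _

theorem eigTau_add (σ τ l : ℝ) : eigTau (σ + τ) l = eigTau σ l * eigTau τ l := by
  rw [eigTau, eigTau, eigTau, ← Real.exp_add, add_mul]

theorem eigTau_eq_one_iff {τ l : ℝ} (hτ : 0 < τ) : eigTau τ l = 1 ↔ l = 1 := by
  rw [eigTau, Real.exp_eq_one_iff, mul_eq_zero, or_iff_right hτ.ne', sub_eq_zero, eq_comm,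
    inv_eq_one]

theorem eigTau_le_exp {τ l : ℝ} (hτ : 0 ≤ τ) (hl : 0 < l) : eigTau τ l ≤ Real.exp τ :=
  Real.exp_le_exp.2 (mul_le_of_le_one_right hτ (by linarith [inv_pos.2 hl]))

/-- This is $e^s\ge s^n/n!$ at $s=\tau/l$. -/
theorem eigTau_le_mul_pow {τ l : ℝ} (hτ : 0 < τ) (hl : 0 < l) (n : ℕ) :
    eigTau τ l ≤ Real.exp τ * n.factorial / τ ^ n * l ^ n := by
  have h1 := Real.pow_div_factorial_le_exp (τ * l⁻¹) (by positivity) n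
  have h2 : eigTau τ l = Real.exp τ / Real.exp (τ * l⁻¹) := by
    rw [eigTau, ← Real.exp_sub]; ring_nf
  rw [h2, div_le_iff₀ (Real.exp_pos _)]
  have hn : (0 : ℝ) < n.factorial := by positivity
  calc Real.exp τ = Real.exp τ * n.factorial / τ ^ n * l ^ n *
        ((τ * l⁻¹) ^ n / n.factorial) := by
        rw [mul_pow, inv_pow]; field_simp
    _ ≤ _ := by gcongr

end EigTau

section PsiTau

variable {M : Type*} [TopologicalSpace M] [CompactSpace M] [MeasurableSpace M] [BorelSpace M]
  {ν : Measure M} [IsFiniteMeasure ν]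

theorem sqrt_eigTau_div_mul_inv_sqrt (τ : ℝ) {l : ℝ} (hl : 0 < l) :
    √(eigTau τ l / l) * (√l)⁻¹ = (√(eigTau τ l))⁻¹ * (eigTau τ l / l ^ 2 * l) := by
  have h1 : √l ≠ 0 := (Real.sqrt_pos.2 hl).ne'
  have h2 : √(eigTau τ l) ≠ 0 := (Real.sqrt_pos.2 (eigTau_pos τ l)).ne'
  have h3 := Real.sq_sqrt hl.le
  have h4 := Real.sq_sqrt (eigTau_pos τ l).le
  rw [Real.sqrt_div (eigTau_pos τ l).le]
  field_simp
  rw [h3, h4, mul_comm]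

/-- With $c=\lambda_\tau/\lambda^2$, the integral operator of $p_\tau$ sends $\phi$ to
$c\lambda\,K\phi$. So this form exhibits $\psi_\tau$ as the normalised eigenfunction
$\lambda_\tau^{-1/2}K_{p_\tau}\phi$. -/
theorem psiTau_eq (k : C(M × M, ℝ)) (τ : ℝ) {l : ℝ} (hl : 0 < l) (φ : Lp ℂ 2 ν) (x : M) :
    psiTau k ν τ l φ x =
      (√(eigTau τ l))⁻¹ * (eigTau τ l / l ^ 2 * l) * (kernelInt k ν φ x).re := by
  rw [psiTau, psi, ← mul_assoc, sqrt_eigTau_div_mul_inv_sqrt τ hl]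

theorem psiTau_mul_psiTau (k : C(M × M, ℝ)) (τ : ℝ) {l : ℝ} (hl : 0 < l) (φ : Lp ℂ 2 ν)
    (x y : M) : psiTau k ν τ l φ x * psiTau k ν τ l φ y =
      eigTau τ l / l ^ 2 * ((kernelInt k ν φ x).re * (kernelInt k ν φ y).re) := by
  rw [psiTau_eq k τ hl, psiTau_eq k τ hl]
  have h1 : (√(eigTau τ l))⁻¹ * (√(eigTau τ l))⁻¹ = (eigTau τ l)⁻¹ := by
    rw [← mul_inv, Real.mul_self_sqrt (eigTau_pos τ l).le]
  have h2 := (eigTau_pos τ l).ne'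
  calc _ = (√(eigTau τ l))⁻¹ * (√(eigTau τ l))⁻¹ * (eigTau τ l / l ^ 2 * l) ^ 2 *
        ((kernelInt k ν φ x).re * (kernelInt k ν φ y).re) := by ring
    _ = _ := by
      rw [h1]
      congr 1
      field_simp

theorem psiTau_add (k : C(M × M, ℝ)) (σ τ : ℝ) {l : ℝ} (φ : Lp ℂ 2 ν) (x : M) :
    psiTau k ν (σ + τ) l φ x = √(eigTau σ l) * psiTau k ν τ l φ x := by
  rw [psiTau, psiTau, eigTau_add, mul_div_assoc, Real.sqrt_mul (eigTau_pos σ l).le, mul_assoc]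

end PsiTau

/-! ### Markov operators and the theorem -/

section Markov

variable {M : Type*} [MeasurableSpace M] {ν : Measure M} [IsFiniteMeasure ν]

theorem integral_eq_inner_const (f : Lp ℂ 2 ν) :
    ∫ x, f x ∂ν = inner ℂ (Lp.const 2 ν (1 : ℂ)) f := by
  rw [L2.inner_def]
  refine integral_congr_ae ?_
  filter_upwards [Lp.coeFn_const (p := 2) (μ := ν) (1 : ℂ)] with x hx
  rw [hx]
  simp

/-- By symmetry, $\int Gf=\langle 1,Gf\rangle=\langle G1,f\rangle=\int f$. -/
theorem isMarkovOp_of_isPositive {G : Lp ℂ 2 ν →L[ℂ] Lp ℂ 2 ν} (hG : G.IsPositive)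
    (hconst : ∀ c : ℂ, G (Lp.const 2 ν c) = Lp.const 2 ν c) : IsMarkovOp G where
  nonneg := hG
  integral_eq f := by
    have h := hG.isSymmetric (Lp.const 2 ν (1 : ℂ)) f
    rw [integral_eq_inner_const, integral_eq_inner_const]
    exact h.symm.trans (congrArg (fun u => inner ℂ u f) (hconst 1))
  map_const := hconst

variable {ι : Type*} {b : HilbertBasis ι ℂ (Lp ℂ 2 ν)} {G T : Lp ℂ 2 ν →L[ℂ] Lp ℂ 2 ν}
  {lam μ : ι → ℝ}

/-- The fixed space of a diagonal operator is determined by the indices with eigenvalue $1$, so the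
constants, fixed by $G$, are fixed by $T$. -/
theorem IsMarkovOp.of_diagonal (hG : IsMarkovOp G) (hGb : ∀ j, G (b j) = (lam j : ℂ) • b j)
    (hTb : ∀ j, T (b j) = (μ j : ℂ) • b j) (hμ : ∀ j, 0 ≤ μ j) (h1 : ∀ j, lam j = 1 → μ j = 1) :
    IsMarkovOp T := by
  refine isMarkovOp_of_isPositive (isPositive_diagonal hTb hμ) fun c => ?_
  rw [diagonal_apply_eq_self_iff hTb]
  exact fun j => ((diagonal_apply_eq_self_iff hGb _).1 (hG.map_const c) j).imp_left (h1 j)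

theorem IsMarkovErgodicOp.of_diagonal (hG : IsMarkovErgodicOp G)
    (hGb : ∀ j, G (b j) = (lam j : ℂ) • b j) (hTb : ∀ j, T (b j) = (μ j : ℂ) • b j)
    (hμ : ∀ j, 0 ≤ μ j) (h1 : ∀ j, lam j = 1 ↔ μ j = 1) : IsMarkovErgodicOp T := by
  refine ⟨hG.1.of_diagonal hGb hTb hμ fun j => (h1 j).1, fun f => ?_⟩
  rw [← hG.2 f, diagonal_apply_eq_self_iff hTb, diagonal_apply_eq_self_iff hGb]
  simp_rw [h1]

end Markov

/-! ### The kernels $p_\tau$: expansion, RKHS, semigroup and nesting -/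

section KernelTau

variable {M : Type*} [TopologicalSpace M] [CompactSpace M] [MeasurableSpace M] [BorelSpace M]
  {ν : Measure M} [IsFiniteMeasure ν] {ι : Type*} {p : C(M × M, ℝ)}
  {φ : HilbertBasis ι ℂ (Lp ℂ 2 ν)} {lam : ι → ℝ}

/-- The kernel `p_τ`. -/
def kernelTau (p : C(M × M, ℝ)) (φ : HilbertBasis ι ℂ (Lp ℂ 2 ν)) (lam : ι → ℝ) (τ : ℝ) :
    C(M × M, ℝ) :=
  sumKernel p (fun j => eigTau τ (lam j) / lam j ^ 2) φ

theorem eigenvalue_pos (hp : IsStrictlyPosOp (kernelOp p ν))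
    (hφ : ∀ j, kernelOp p ν (φ j) = (lam j : ℂ) • φ j) (j : ι) : 0 < lam j := by
  have h := hp.2 (φ j) (φ.orthonormal.ne_zero j)
  rw [hφ, inner_smul_right, inner_self_eq_norm_sq_to_K, φ.orthonormal.1 j] at h
  simpa using h

theorem coeff_nonneg (lam : ι → ℝ) (τ : ℝ) (j : ι) : 0 ≤ eigTau τ (lam j) / lam j ^ 2 :=
  div_nonneg (eigTau_pos _ _).le (sq_nonneg _)

theorem summable_coeff (hlam : ∀ j, 0 < lam j) (hsum : Summable fun j => lam j ^ 2)
    {τ : ℝ} (hτ : 0 < τ) : Summable fun j => eigTau τ (lam j) / lam j ^ 2 := by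
  refine Summable.of_nonneg_of_le (coeff_nonneg lam τ) (fun j => ?_)
    -- The power $4$ is chosen so that division by $\lambda_j^2$ leaves the summable $\lambda_j^2$.
    (hsum.mul_left (Real.exp τ * Nat.factorial 4 / τ ^ 4))
  rw [div_le_iff₀ (pow_pos (hlam j) 2)]
  refine (eigTau_le_mul_pow hτ (hlam j) 4).trans_eq ?_
  ring

theorem hasSum_kernelTau (hlam : ∀ j, 0 < lam j) (hsum : Summable fun j => lam j ^ 2)
    {τ : ℝ} (hτ : 0 < τ) (x y : M) :
    HasSum (fun j => psiTau p ν τ (lam j) (φ j) x * psiTau p ν τ (lam j) (φ j) y)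
      (kernelTau p φ lam τ (x, y)) :=
  (hasSum_sumKernel p (summable_coeff hlam hsum hτ) (coeff_nonneg lam τ)
    φ.orthonormal.1 x y).congr_fun fun j => psiTau_mul_psiTau p τ (hlam j) (φ j) x y

theorem isSymmKernel_kernelTau (hlam : ∀ j, 0 < lam j) (hsum : Summable fun j => lam j ^ 2)
    {τ : ℝ} (hτ : 0 < τ) : IsSymmKernel (kernelTau p φ lam τ) := fun x y =>
  (hasSum_kernelTau hlam hsum hτ x y).unique
    ((hasSum_kernelTau hlam hsum hτ y x).congr_fun fun _ => mul_comm _ _)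

theorem kernelOp_kernelTau (hlam : ∀ j, 0 < lam j) (hφ_real : ∀ j, ∀ᵐ x ∂ν, (φ j x).im = 0)
    (hφ : ∀ j, kernelOp p ν (φ j) = (lam j : ℂ) • φ j) {τ : ℝ} (hτ : 0 < τ) (j : ι) :
    kernelOp (kernelTau p φ lam τ) ν (φ j) = (eigTau τ (lam j) : ℂ) • φ j := by
  rw [kernelTau, kernelOp_sumKernel (summable_coeff hlam (summable_eigenvalue_sq hφ_real hφ) hτ)
    (coeff_nonneg lam τ) hφ_real hφ, div_mul_cancel₀ _ (pow_ne_zero 2 (hlam j).ne')]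

theorem rkhsEigenfunction_kernelTau (hlam : ∀ j, 0 < lam j)
    (hφ_real : ∀ j, ∀ᵐ x ∂ν, (φ j x).im = 0)
    (hφ : ∀ j, kernelOp p ν (φ j) = (lam j : ℂ) • φ j) {τ : ℝ} (hτ : 0 < τ)
    {𝓗 : Type*} [NormedAddCommGroup 𝓗] [InnerProductSpace ℂ 𝓗] [CompleteSpace 𝓗] [RKHS ℂ 𝓗 M ℂ]
    (h : HasReproducingKernel 𝓗 (kernelTau p φ lam τ)) (j : ι) (x : M) :
    rkhsEigenfunction h φ (fun j => eigTau τ (lam j)) j x =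
      (psiTau p ν τ (lam j) (φ j) x : ℂ) := by
  have hsum := summable_eigenvalue_sq hφ_real hφ
  rw [rkhsEigenfunction_apply h (isSymmKernel_kernelTau hlam hsum hτ), kernelTau,
    kernelInt_sumKernel (summable_coeff hlam hsum hτ) (coeff_nonneg lam τ) hφ_real hφ,
    ContinuousMap.smul_apply, kernelInt_eq_ofReal_re p (hφ_real j), psiTau_eq p τ (hlam j),
    smul_eq_mul]
  push_cast
  ring

theorem exists_hilbertBasis_kernelTau (hlam : ∀ j, 0 < lam j)
    (hφ_real : ∀ j, ∀ᵐ x ∂ν, (φ j x).im = 0)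
    (hφ : ∀ j, kernelOp p ν (φ j) = (lam j : ℂ) • φ j) {τ : ℝ} (hτ : 0 < τ)
    {𝓗 : Type*} [NormedAddCommGroup 𝓗] [InnerProductSpace ℂ 𝓗] [CompleteSpace 𝓗] [RKHS ℂ 𝓗 M ℂ]
    (h : HasReproducingKernel 𝓗 (kernelTau p φ lam τ)) :
    ∃ b : HilbertBasis ι ℂ 𝓗, ∀ j x, b j x = (psiTau p ν τ (lam j) (φ j) x : ℂ) := by
  have hsum := summable_eigenvalue_sq hφ_real hφ
  have hsymm : IsSymmKernel (kernelTau p φ lam τ) := isSymmKernel_kernelTau hlam hsum hτ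
  have he := rkhsEigenfunction_kernelTau hlam hφ_real hφ hτ h
  obtain ⟨b, hb⟩ := exists_hilbertBasis_of_hasSum (X := M)
    (orthonormal_rkhsEigenfunction h hsymm (fun j => eigTau_pos τ (lam j))
      (kernelOp_kernelTau hlam hφ_real hφ hτ)) (fun x y => by
        rw [h y x, hsymm y x]
        refine (Complex.hasSum_ofReal.2 (hasSum_kernelTau hlam hsum hτ x y)).congr_fun fun j => ?_
        rw [he, he, Complex.conj_ofReal, Complex.ofReal_mul])
  exact ⟨b, fun j x => by rw [hb, he]⟩

theorem tendstoCr_kernelTau {E H : Type*} [NormedAddCommGroup E] [NormedSpace ℝ E]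
    [FiniteDimensional ℝ E] [TopologicalSpace H] {I : ModelWithCorners ℝ E H} [ChartedSpace H M]
    {r : ℕ} [IsManifold I r M] (hp : ContMDiff (I.prod I) 𝓘(ℝ, ℝ) r p) (hlam : ∀ j, 0 < lam j)
    (hsum : Summable fun j => lam j ^ 2) {τ : ℝ} (hτ : 0 < τ) :
    TendstoCr (I.prod I) r
      (fun (s : Finset ι) (z : M × M) =>
        ∑ j ∈ s, psiTau p ν τ (lam j) (φ j) z.1 * psiTau p ν τ (lam j) (φ j) z.2)
      atTop (kernelTau p φ lam τ) := by
  have hΦ : ContMDiff I 𝓘(ℝ, Lp ℂ 2 ν) r (kernelSection p ν) :=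
    (realToLp ν).contMDiff.comp (contMDiff_curry hp)
  have hB := hasSum_sumForm (summable_coeff hlam hsum hτ)
    (coeff_nonneg lam τ) fun j => (norm_reInner_le (φ j)).trans_eq (φ.orthonormal.1 j)
  rw [HasSum, SummationFilter.unconditional_filter] at hB
  convert tendstoCr_of_tendsto_bilinear hΦ hB using 3 with s z
  · rw [sum_apply, sum_apply]
    refine Finset.sum_congr rfl fun j _ => ?_
    rw [psiTau_mul_psiTau p τ (hlam j), ← reInner_kernelSection, ← reInner_kernelSection]
    rfl
  · rfl

theorem kernelFamilyOp_kernelTau (hlam : ∀ j, 0 < lam j) (hφ_real : ∀ j, ∀ᵐ x ∂ν, (φ j x).im = 0)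
    (hφ : ∀ j, kernelOp p ν (φ j) = (lam j : ℂ) • φ j) (t : ℝ≥0) (j : ι) :
    kernelFamilyOp (kernelTau p φ lam) ν t (φ j) = (eigTau t (lam j) : ℂ) • φ j := by
  by_cases ht : t = 0
  · simp [kernelFamilyOp, ht, eigTau]
  · rw [kernelFamilyOp, if_neg ht]
    exact kernelOp_kernelTau hlam hφ_real hφ (NNReal.coe_pos.2 (pos_iff_ne_zero.2 ht)) j

theorem isSelfAdjointMarkovSemigroup_kernelTau (hp : IsMarkovOp (kernelOp p ν))
    (hlam : ∀ j, 0 < lam j) (hφ_real : ∀ j, ∀ᵐ x ∂ν, (φ j x).im = 0)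
    (hφ : ∀ j, kernelOp p ν (φ j) = (lam j : ℂ) • φ j) :
    IsSelfAdjointMarkovSemigroup (kernelFamilyOp (kernelTau p φ lam) ν) := by
  have hT := kernelFamilyOp_kernelTau hlam hφ_real hφ
  refine ⟨by simp [kernelFamilyOp], fun s t => ?_, fun f => ?_, fun t => ?_, fun t => ?_⟩
  · refine ContinuousLinearMap.ext fun f => φ.ext_inner fun j => ?_
    rw [ContinuousLinearMap.comp_apply, inner_diagonal_apply (hT _), inner_diagonal_apply (hT _),
      inner_diagonal_apply (hT _), NNReal.coe_add, eigTau_add]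
    push_cast
    ring
  -- Only $\lambda_j>0$ is needed for $1-1/\lambda_j\le1$; no upper bound on $\lambda_j$ enters.
  · exact continuous_diagonal_semigroup (a := fun j => 1 - (lam j)⁻¹)
      (fun j => by linarith [inv_pos.2 (hlam j)]) hT f
  · exact (isPositive_diagonal (hT t) fun j => (eigTau_pos _ _).le).isSelfAdjoint
  · exact hp.of_diagonal hφ (hT t) (fun j => (eigTau_pos _ _).le)
      fun j hj => by simp [eigTau, hj]

/-- The weights are $\psi_{\tau_2,j}/\psi_{\tau_1,j}=\sqrt{\lambda_{\tau_2-\tau_1,j}}$, bounded by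
$e^{(\tau_2-\tau_1)/2}$. -/
theorem rkhsFunctions_kernelTau_subset (hlam : ∀ j, 0 < lam j)
    (hφ_real : ∀ j, ∀ᵐ x ∂ν, (φ j x).im = 0)
    (hφ : ∀ j, kernelOp p ν (φ j) = (lam j : ℂ) • φ j) {τ₁ τ₂ : ℝ} (hτ₁ : 0 < τ₁) (hτ : τ₁ < τ₂)
    {𝓗₁ : Type*} [NormedAddCommGroup 𝓗₁] [InnerProductSpace ℂ 𝓗₁] [CompleteSpace 𝓗₁]
    [RKHS ℂ 𝓗₁ M ℂ]
    {𝓗₂ : Type*} [NormedAddCommGroup 𝓗₂] [InnerProductSpace ℂ 𝓗₂] [CompleteSpace 𝓗₂]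
    [RKHS ℂ 𝓗₂ M ℂ] (h₁ : HasReproducingKernel 𝓗₁ (kernelTau p φ lam τ₁))
    (h₂ : HasReproducingKernel 𝓗₂ (kernelTau p φ lam τ₂)) :
    rkhsFunctions (M := M) 𝓗₂ ⊆ rkhsFunctions (M := M) 𝓗₁ := by
  obtain ⟨b₁, hb₁⟩ := exists_hilbertBasis_kernelTau hlam hφ_real hφ hτ₁ h₁
  obtain ⟨b₂, hb₂⟩ := exists_hilbertBasis_kernelTau hlam hφ_real hφ (hτ₁.trans hτ) h₂
  refine rkhsFunctions_subset b₂ b₁.orthonormal (w := fun j => √(eigTau (τ₂ - τ₁) (lam j)))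
    (C := √(Real.exp (τ₂ - τ₁))) (fun j => ?_) fun j x => ?_
  · rw [abs_of_nonneg (Real.sqrt_nonneg _)]
    exact Real.sqrt_le_sqrt (eigTau_le_exp (sub_pos.2 hτ).le (hlam j))
  · rw [hb₁, hb₂, ← Complex.ofReal_mul, ← psiTau_add, sub_add_cancel]

/-- The weights are $\sqrt{\lambda_{\tau,j}/\lambda_j}$, bounded because
$\lambda_{\tau,j}\le(e^\tau/\tau)\lambda_j$. Orthonormality of the $\psi_j$ in $\mathcal H$ is
enough; their completeness is not used. -/
theorem rkhsFunctions_kernelTau_subset_rkhsFunctions (hp : IsSymmKernel p) (hlam : ∀ j, 0 < lam j)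
    (hφ_real : ∀ j, ∀ᵐ x ∂ν, (φ j x).im = 0)
    (hφ : ∀ j, kernelOp p ν (φ j) = (lam j : ℂ) • φ j) {τ : ℝ} (hτ : 0 < τ)
    {𝓗 : Type*} [NormedAddCommGroup 𝓗] [InnerProductSpace ℂ 𝓗] [CompleteSpace 𝓗]
    [RKHS ℂ 𝓗 M ℂ]
    {𝓗₁ : Type*} [NormedAddCommGroup 𝓗₁] [InnerProductSpace ℂ 𝓗₁] [CompleteSpace 𝓗₁]
    [RKHS ℂ 𝓗₁ M ℂ] (h : HasReproducingKernel 𝓗 p)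
    (h₁ : HasReproducingKernel 𝓗₁ (kernelTau p φ lam τ)) :
    rkhsFunctions (M := M) 𝓗₁ ⊆ rkhsFunctions (M := M) 𝓗 := by
  obtain ⟨b₁, hb₁⟩ := exists_hilbertBasis_kernelTau hlam hφ_real hφ hτ h₁
  refine rkhsFunctions_subset b₁ (orthonormal_rkhsEigenfunction h hp hlam hφ)
    (w := fun j => √(eigTau τ (lam j) / lam j))
    (C := √(Real.exp τ * Nat.factorial 1 / τ ^ 1)) (fun j => ?_) fun j x => ?_
  · rw [abs_of_nonneg (Real.sqrt_nonneg _)]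
    refine Real.sqrt_le_sqrt ((div_le_iff₀ (hlam j)).2 ?_)
    simpa using eigTau_le_mul_pow hτ (hlam j) 1
  · rw [hb₁, rkhsEigenfunction_apply h hp, kernelInt_eq_ofReal_re p (hφ_real j), psiTau, psi]
    push_cast
    rfl

end KernelTau

end

theorem theorem1
    {E H M ι : Type*} [NormedAddCommGroup E] [NormedSpace ℝ E] [FiniteDimensional ℝ E]
    [TopologicalSpace H] (I : ModelWithCorners ℝ E H)
    [TopologicalSpace M] [T2Space M] [CompactSpace M] [ChartedSpace H M]
    (r : ℕ) [IsManifold I r M]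
    [MeasurableSpace M] [BorelSpace M] (ν : Measure M) [IsProbabilityMeasure ν]
    (p : C(M × M, ℝ)) (hp_smooth : ContMDiff (I.prod I) 𝓘(ℝ, ℝ) r p)
    (hp_symm : IsSymmKernel p) (hp_posDef : IsPosDefKernel p)
    (hp_strict : IsStrictlyPosOp (kernelOp p ν))
    (hp_markov : IsMarkovErgodicOp (kernelOp p ν))
    -- a real orthonormal basis of eigenfunctions, with the corresponding eigenvalues
    (φ : HilbertBasis ι ℂ (Lp ℂ 2 ν)) (hφ_real : ∀ j, ∀ᵐ x ∂ν, (φ j x).im = 0)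
    (lam : ι → ℝ) (hφ_eigen : ∀ j, kernelOp p ν (φ j) = (lam j : ℂ) • φ j) :
    ∃ q : ℝ → C(M × M, ℝ),
      -- convergence of the series, regularity and symmetry of the limit
      (∀ τ : ℝ, 0 < τ →
        TendstoCr (I.prod I) r
          (fun (s : Finset ι) (z : M × M) =>
            ∑ j ∈ s, psiTau p ν τ (lam j) (φ j) z.1 * psiTau p ν τ (lam j) (φ j) z.2)
          atTop (q τ) ∧
        ContMDiff (I.prod I) 𝓘(ℝ, ℝ) r (q τ) ∧ IsSymmKernel (q τ)) ∧
      -- positivity and the ergodic Markov property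
      (∀ τ : ℝ, 0 < τ →
        IsPosDefKernel (q τ) ∧ IsStrictlyPosOp (kernelOp (q τ) ν) ∧
          IsMarkovErgodicOp (kernelOp (q τ) ν)) ∧
      -- density, orthonormal basis, and the integral operator `P_τ` with `G_τ = P_τ^* P_τ`
      (∀ τ : ℝ, 0 < τ →
        ∀ (𝓗τ : Type*) [NormedAddCommGroup 𝓗τ] [InnerProductSpace ℂ 𝓗τ] [CompleteSpace 𝓗τ]
          [RKHS ℂ 𝓗τ M ℂ], HasReproducingKernel 𝓗τ (q τ) →
          IsDenseInL2 𝓗τ ν ∧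
          (∃ b : HilbertBasis ι ℂ 𝓗τ, ∀ j x, b j x = (psiTau p ν τ (lam j) (φ j) x : ℂ)) ∧
          (∃ P : Lp ℂ 2 ν →L[ℂ] 𝓗τ, (∀ f x, P f x = ∫ y, (q τ (x, y) : ℂ) * f y ∂ν) ∧
            kernelOp (q τ) ν = P.adjoint ∘L P)) ∧
      -- nesting
      (∀ τ₁ τ₂ : ℝ, 0 < τ₁ → τ₁ < τ₂ →
        ∀ (𝓗 : Type*) [NormedAddCommGroup 𝓗] [InnerProductSpace ℂ 𝓗] [CompleteSpace 𝓗]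
          [RKHS ℂ 𝓗 M ℂ]
          (𝓗₁ : Type*) [NormedAddCommGroup 𝓗₁] [InnerProductSpace ℂ 𝓗₁] [CompleteSpace 𝓗₁]
          [RKHS ℂ 𝓗₁ M ℂ]
          (𝓗₂ : Type*) [NormedAddCommGroup 𝓗₂] [InnerProductSpace ℂ 𝓗₂] [CompleteSpace 𝓗₂]
          [RKHS ℂ 𝓗₂ M ℂ],
          HasReproducingKernel 𝓗 p → HasReproducingKernel 𝓗₁ (q τ₁) →
          HasReproducingKernel 𝓗₂ (q τ₂) →
          rkhsFunctions 𝓗₂ ⊆ rkhsFunctions 𝓗₁ ∧ rkhsFunctions 𝓗₁ ⊆ rkhsFunctions 𝓗) ∧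
      -- the semigroup
      IsSelfAdjointMarkovSemigroup (kernelFamilyOp q ν) := by
  have hlam := eigenvalue_pos hp_strict hφ_eigen
  have hsum := summable_eigenvalue_sq hφ_real hφ_eigen
  have hop : ∀ τ : ℝ, 0 < τ → ∀ j, kernelOp (kernelTau p φ lam τ) ν (φ j) =
      (eigTau τ (lam j) : ℂ) • φ j := fun τ hτ => kernelOp_kernelTau hlam hφ_real hφ_eigen hτ
  refine ⟨kernelTau p φ lam, fun τ hτ => ?_, fun τ hτ => ?_, ?_, ?_,
    isSelfAdjointMarkovSemigroup_kernelTau hp_markov.1 hlam hφ_real hφ_eigen⟩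
  · have hconv := tendstoCr_kernelTau (ν := ν) (φ := φ) hp_smooth hlam hsum hτ
    exact ⟨hconv, hconv.2.1, isSymmKernel_kernelTau hlam hsum hτ⟩
  · refine ⟨isPosDefKernel_sumKernel p (summable_coeff hlam hsum hτ) (coeff_nonneg lam τ)
      φ.orthonormal.1, ⟨?_, ?_⟩, ?_⟩
    · exact isPositive_diagonal (hop τ hτ) fun j => (eigTau_pos _ _).le
    · exact fun f hf => inner_diagonal_pos (hop τ hτ) (fun j => eigTau_pos _ _) hf
    · exact hp_markov.of_diagonal hφ_eigen (hop τ hτ) (fun j => (eigTau_pos _ _).le)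
        fun j => (eigTau_eq_one_iff hτ).symm
  · intro τ hτ 𝓗τ _ _ _ _ h
    have hsymm : IsSymmKernel (kernelTau p φ lam τ) := isSymmKernel_kernelTau hlam hsum hτ
    refine ⟨isDenseInL2_of_eigenbasis h hsymm (fun j => eigTau_pos τ (lam j)) (hop τ hτ),
      exists_hilbertBasis_kernelTau hlam hφ_real hφ_eigen hτ h, (rkhsToL2 ν h).adjoint,
      adjoint_rkhsToL2_apply ν h hsymm, ?_⟩
    rw [ContinuousLinearMap.adjoint_adjoint, rkhsToL2_comp_adjoint ν h hsymm]
  · intro τ₁ τ₂ hτ₁ hτ 𝓗 _ _ _ _ 𝓗₁ _ _ _ _ 𝓗₂ _ _ _ _ h h₁ h₂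
    exact ⟨rkhsFunctions_kernelTau_subset hlam hφ_real hφ_eigen hτ₁ hτ h₁ h₂,
      rkhsFunctions_kernelTau_subset_rkhsFunctions hp_symm hlam hφ_real hφ_eigen hτ₁ h h₁⟩
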